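/- **Setting.** Graphs are locally finite, simple and undirected, and carry attributes: node features $x_v\in\mathbb R^F$, node targets $y_v$, and edge attributes. $\mathcal G_*$ is the set of rooted graphs with attributes $(G,o)$, with the local metric $d_{loc}=1/(1+\inf\{k: B_k(G_1,o_1)\not\simeq B_k(G_2,o_2)\})$ and its Borel $\sigma$-algebra. Here $B_k$ is the $k$-hop neighbourhood of the root and $\simeq$ is isomorphism of rooted graphs with attributes. A sequence of random graphs $G_n$ with $n$ nodes *converges locally in probability* to a probability measure $\mu$ on $\mathcal G_*$ if $\frac1n\sum_{v}f(G_n,v)\to\mathbb E_\mu[f(G,o)]$ in probability for every bounded $d_{loc}$-continuous $f:\mathcal G_*\to\mathbb R$. A function $f:\mathcal G_*\to\mathbb R$ is *almost local* with limit function $\tilde f$ (which may depend on $\mu$) if, for every sequence $G_n$ converging locally in probability to some $\mu$, $\tilde f$ is $\mu$-integrable and $\frac1n\sum_v f(G_n,v)\to\mathbb E_\mu[\tilde f(G,o)]$ in probability. A sampling-based GNN with $L$ layers and learning coefficients $W\in\mathbb R^p$ consists of maps $\mathtt{AGGREGATE}_\ell$, $\mathtt{COMBINE}_\ell$, a computational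 graph sampler $\nu_C$ and a loss. For a graph $G$ and node $v$, $\nu_C(G,v)$ is a random choice, for each layer, of the neighbour-to-neighbour connections of $G$ that are kept. Forward propagation on the sampled computational graph $C$ is $h^{(0)}_u=x_u$, $h^{(\ell+1)}_u=\mathtt{COMBINE}_\ell\big(h^{(\ell)}_u,\mathtt{AGGREGATE}_\ell(\{h^{(\ell)}_w: w\to u\text{ kept in layer }\ell\})\big)$. The result is a loss $\mathcal L(W;G,v,C)$ at the node $v$, computed from the output embeddings and the attributes. Write $\mathcal L(W;G,v)=\mathbb E_{C\sim\nu_C(G,v)}[\mathcal L(W;G,v,C)]$. *Training algorithm.* Given a learning rate $\eta$, a subgraph size $n$ and a minibatch rule, draw $W_0\sim\pi_0$. In step $t$, independently of the past, draw an $n$-node graph $G_t\sim\mu_S$ and a minibatch $V_B$ of its nodes. The minibatch is either $b$ nodes drawn i.i.d. uniformly or all nodes. For each $v\in V_B$ draw independently $C_v\sim\nu_C(G_t,v)$, and set $$W_{t+1}=W_t-\frac{\eta}{|V_B|}\sum_{v\in V_B}\nabla_W\mathcal L(W_t;G_t,v,C_v).$$ **Theorem.** Assume: (i) $\mathcal L(W;G,v,C)$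 is measurable in $G$ and, for almost every sampled graph $G$ and all $v,C$, is bounded by a constant $M$ and differentiable in $W$, and $\mathcal L$ and $\nabla_W\mathcal L$ are $K$-Lipschitz in $W$; (ii) for every $W$ the loss of the sampling-based GNN, $(G,v)\mapsto\mathcal L(W;G,v)$, is almost local with limit function $\tilde{\mathcal L}_W$; (iii) the random $n$-node graphs produced by the subgraph sampler $\mu_S$ converge locally in probability to a probability measure $\mu$ on $\mathcal G_*$. Let $\mathcal L_\mu(W)=\mathbb E_{(G,o)\sim\mu}[\tilde{\mathcal L}_W(G,o)]$ be the loss of the limit GNN. Then $\mathcal L_\mu$ is differentiable, and there exist a learning rate $\eta>0$ and a constant $A>0$, neither depending on $\pi_0$ or $\epsilon$, such that the following holds for every initial law $\pi_0$. For $\epsilon>0$ let $\tau_\epsilon=\inf\{t:|\nabla\mathcal L_\mu(W_t)|\le\epsilon\}$ be the number of training steps, equivalently of subgraph samples, performed before the limit gradient is at most $\epsilon$. 1. For every $\epsilon>0$ and every $T\in\mathbb N$ there are $N_\epsilon$ and $Y_\epsilon$ (which may also depend on $T$ and $\pi_0$) such that, whenever training uses subgraphs of size $n\ge N_\epsilon$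 and minibatches that have at least $Y_\epsilon$ nodes or contain all nodes, there is a number of steps $t\le A/\epsilon^2$ with $$\mathbb E\big[\,|\nabla\mathcal L_\mu(W_t)|\,\big]\le\epsilon ,$$ and the expected number of steps, capped at $T$, satisfies $\mathbb E[\min(\tau_\epsilon,T)]\le A/\epsilon^2$. 2. If, moreover, the convergence in probability $\frac1n\sum_v\mathcal L(W;G_n,v)\to\mathcal L_\mu(W)$ is uniform in $W$ (for every $\delta>0$, for all large $n$ and all $W$, $\mathbb P(|\frac1n\sum_v\mathcal L(W;G_n,v)-\mathcal L_\mu(W)|\ge\delta)\le\delta$), then for every $\epsilon>0$ there are $N_\epsilon,Y_\epsilon$ such that for all $n\ge N_\epsilon$ and all minibatches as above $\mathbb E[\tau_\epsilon]\le A/\epsilon^2$. All these step counts are $O(1/\epsilon^2)$, in particular $\tilde O(1/\epsilon^2)$. -/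

import Mathlib

open MeasureTheory ProbabilityTheory Filter Topology
open scoped ENNReal NNReal

noncomputable section

/-- The Euclidean space `ℝᵏ` (features, embeddings, learning coefficients). -/
abbrev Vec (k : ℕ) : Type := EuclideanSpace ℝ (Fin k)

/-! ### Graphs with attributes, rooted graphs, local metric -/

/-- A locally finite graph on the vertex set `V` with attributes: every node carries an input
feature `x v ∈ ℝᶠ` and a target feature `y v ∈ 𝒴`, every edge `uv` carries an attribute
`e u v ∈ ℰ` (the values of `e` on non-edges are irrelevant, see `RootedGraph.Iso`). -/
structure AttrGraph (F : ℕ) (𝒴 ℰ : Type) (V : Type) where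
  graph : SimpleGraph V
  x : V → Vec F
  y : V → 𝒴
  e : V → V → ℰ
  finite_nbhd : ∀ v, {u | graph.Adj v u}.Finite

/-- The `σ`-algebra on attributed graphs generated by the adjacencies and the attributes. -/
instance AttrGraph.instMeasurableSpace {F : ℕ} {𝒴 ℰ : Type} [MeasurableSpace 𝒴]
    [MeasurableSpace ℰ] {V : Type} : MeasurableSpace (AttrGraph F 𝒴 ℰ V) :=
  MeasurableSpace.comap
    (fun G => ((fun u v => G.graph.Adj u v, G.x), (G.y, G.e)) :
      AttrGraph F 𝒴 ℰ V → ((V → V → Prop) × (V → Vec F)) × ((V → 𝒴) × (V → V → ℰ)))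
    inferInstance

/-- A rooted graph with attributes, i.e. an element `(G, o)` of `𝒢_*` (finite or infinite). -/
structure RootedGraph (F : ℕ) (𝒴 ℰ : Type) where
  V : Type
  G : AttrGraph F 𝒴 ℰ V
  root : V

namespace RootedGraph

variable {F : ℕ} {𝒴 ℰ : Type}

/-- Isomorphism of rooted graphs with attributes. -/
def Iso (R R' : RootedGraph F 𝒴 ℰ) : Prop :=
  ∃ φ : R.V ≃ R'.V, φ R.root = R'.root ∧
    (∀ u v, R.G.graph.Adj u v ↔ R'.G.graph.Adj (φ u) (φ v)) ∧
    (∀ v, R.G.x v = R'.G.x (φ v)) ∧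
    (∀ v, R.G.y v = R'.G.y (φ v)) ∧
    (∀ u v, R.G.graph.Adj u v → R.G.e u v = R'.G.e (φ u) (φ v))

theorem Iso.refl (R : RootedGraph F 𝒴 ℰ) : Iso R R :=
  ⟨Equiv.refl _, rfl, fun _ _ => Iff.rfl, fun _ => rfl, fun _ => rfl, fun _ _ _ => rfl⟩

theorem Iso.symm {R R' : RootedGraph F 𝒴 ℰ} (h : Iso R R') : Iso R' R := by
  obtain ⟨φ, h0, h1, h2, h3, h4⟩ := h
  refine ⟨φ.symm, ?_, fun u v => ?_, fun v => ?_, fun v => ?_, fun u v huv => ?_⟩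
  · rw [← h0, Equiv.symm_apply_apply]
  · rw [h1, Equiv.apply_symm_apply, Equiv.apply_symm_apply]
  · rw [h2, Equiv.apply_symm_apply]
  · rw [h3, Equiv.apply_symm_apply]
  · rw [h4, Equiv.apply_symm_apply, Equiv.apply_symm_apply]
    rwa [h1, Equiv.apply_symm_apply, Equiv.apply_symm_apply]

theorem Iso.trans {R R' R'' : RootedGraph F 𝒴 ℰ} (h : Iso R R') (h' : Iso R' R'') :
    Iso R R'' := by
  obtain ⟨φ, h0, h1, h2, h3, h4⟩ := h
  obtain ⟨ψ, k0, k1, k2, k3, k4⟩ := h'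
  refine ⟨φ.trans ψ, ?_, fun u v => ?_, fun v => ?_, fun v => ?_, fun u v huv => ?_⟩
  · simp [h0, k0]
  · simp [h1, k1]
  · simp [h2, k2]
  · simp [h3, k3]
  · simp only [Equiv.trans_apply]
    rw [h4 u v huv, k4 _ _ ((h1 u v).1 huv)]

/-- The `k`-hop neighbourhood `B_k(G, o)` of the root, as a rooted graph with attributes. -/
def ball (k : ℕ) (R : RootedGraph F 𝒴 ℰ) : RootedGraph F 𝒴 ℰ where
  V := {v : R.V // R.G.graph.edist R.root v ≤ k}
  G :=
    { graph := R.G.graph.comap Subtype.val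
      x := fun v => R.G.x v
      y := fun v => R.G.y v
      e := fun u v => R.G.e u v
      finite_nbhd := fun v =>
        (R.G.finite_nbhd v.1).preimage Subtype.val_injective.injOn }
  root := ⟨R.root, by simp⟩

/-- The radii at which the neighbourhoods of the two roots differ. -/
def badRadii (R R' : RootedGraph F 𝒴 ℰ) : Set ℕ := {k | ¬ Iso (ball k R) (ball k R')}

open Classical in
/-- The local metric `d_loc = 1 / (1 + inf {k : B_k ≄ B'_k})`, with value `0` if all the
neighbourhoods are isomorphic. -/
def dloc (R R' : RootedGraph F 𝒴 ℰ) : ℝ :=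
  if (badRadii R R').Nonempty then 1 / (1 + (sInf (badRadii R R') : ℕ)) else 0

theorem badRadii_comm (R R' : RootedGraph F 𝒴 ℰ) : badRadii R R' = badRadii R' R := by
  ext k
  exact not_congr ⟨Iso.symm, Iso.symm⟩

theorem dloc_nonneg (R R' : RootedGraph F 𝒴 ℰ) : 0 ≤ dloc R R' := by
  unfold dloc
  split_ifs
  · positivity
  · exact le_rfl

theorem le_dloc {R R' : RootedGraph F 𝒴 ℰ} {k : ℕ} (hk : k ∈ badRadii R R') :
    1 / (1 + (k : ℝ)) ≤ dloc R R' := by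
  unfold dloc
  rw [if_pos ⟨k, hk⟩]
  have : ((sInf (badRadii R R') : ℕ) : ℝ) ≤ k := by exact_mod_cast Nat.sInf_le hk
  gcongr

/-- `d_loc` makes the set `𝒢_*` of rooted graphs a (pseudo)metric space. -/
instance instPseudoMetricSpace : PseudoMetricSpace (RootedGraph F 𝒴 ℰ) where
  dist := dloc
  dist_self R := by
    have : ¬ (badRadii R R).Nonempty := fun ⟨k, hk⟩ => hk (Iso.refl _)
    simp [dloc, this]
  dist_comm R R' := by
    unfold dloc
    rw [badRadii_comm R R']
  dist_triangle R R' R'' := by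
    by_cases h : (badRadii R R'').Nonempty
    · have hm := Nat.sInf_mem h
      have key : sInf (badRadii R R'') ∈ badRadii R R' ∨
          sInf (badRadii R R'') ∈ badRadii R' R'' := by
        by_contra hc
        simp only [badRadii, Set.mem_ofPred_eq] at hm hc
        push Not at hc
        exact hm (hc.1.trans hc.2)
      have he : dloc R R'' = 1 / (1 + (sInf (badRadii R R'') : ℕ)) := by
        simp only [dloc, if_pos h]
      rw [he]
      rcases key with h1 | h1
      · linarith [le_dloc h1, dloc_nonneg R' R'']
      · linarith [le_dloc h1, dloc_nonneg R R']
    · have he : dloc R R'' = 0 := by simp only [dloc, if_neg h]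
      rw [he]
      exact add_nonneg (dloc_nonneg _ _) (dloc_nonneg _ _)

instance instMeasurableSpace : MeasurableSpace (RootedGraph F 𝒴 ℰ) := borel _

instance instBorelSpace : BorelSpace (RootedGraph F 𝒴 ℰ) := ⟨rfl⟩

end RootedGraph

/-- The rooted graph `(G, v)`. -/
def AttrGraph.rootAt {F : ℕ} {𝒴 ℰ V : Type} (G : AttrGraph F 𝒴 ℰ V) (v : V) :
    RootedGraph F 𝒴 ℰ := ⟨V, G, v⟩

/-! ### Local convergence and almost local functions -/

section Local

variable {F : ℕ} {𝒴 ℰ : Type} [MeasurableSpace 𝒴] [MeasurableSpace ℰ]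

/-- `𝔼_{v ∼ 𝒫_n}[f(G, v)]`: the mean of `f` over a uniform random root of the `n`-node graph. -/
def rootMean (f : RootedGraph F 𝒴 ℰ → ℝ) {n : ℕ} (G : AttrGraph F 𝒴 ℰ (Fin n)) : ℝ :=
  (∑ v : Fin n, f (G.rootAt v)) / n

/-- `𝔼_{v ∼ 𝒫_n}[f(G_n, v) | G_n] → c` in probability, where `γ n` is the law of the random
`n`-node graph `G_n`. -/
def RootMeanTendsto (γ : ∀ n, Measure (AttrGraph F 𝒴 ℰ (Fin n)))
    (f : RootedGraph F 𝒴 ℰ → ℝ) (c : ℝ) : Prop :=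
  ∀ δ : ℝ, 0 < δ → Tendsto (fun n => γ n {G | δ ≤ |rootMean f G - c|}) atTop (𝓝 0)

/-- Local convergence in probability of the sequence of random graphs `G_n ∼ γ n` to the limit
graph `(G, o) ∼ μ`, through bounded continuous (for `d_loc`) functions of the rooted graph. -/
def LocallyConverges (γ : ∀ n, Measure (AttrGraph F 𝒴 ℰ (Fin n)))
    (μ : Measure (RootedGraph F 𝒴 ℰ)) : Prop :=
  ∀ f : RootedGraph F 𝒴 ℰ → ℝ, Continuous f → (∃ B : ℝ, ∀ R, |f R| ≤ B) →
    RootMeanTendsto γ f (∫ R, f R ∂μ)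

/-- `f : 𝒢_* → ℝ` is almost local with limit function `flim μ` on the limit graph `μ`: along every
sequence of random graphs that converges locally in probability to some `μ`, the mean of `f` over
a uniform root converges in probability to `𝔼_μ[flim μ]`. -/
def AlmostLocal (f : RootedGraph F 𝒴 ℰ → ℝ)
    (flim : Measure (RootedGraph F 𝒴 ℰ) → RootedGraph F 𝒴 ℰ → ℝ) : Prop :=
  ∀ (γ : ∀ n, Measure (AttrGraph F 𝒴 ℰ (Fin n))) (μ : Measure (RootedGraph F 𝒴 ℰ)),
    (∀ n, IsProbabilityMeasure (γ n)) → IsProbabilityMeasure μ → LocallyConverges γ μ →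
      Integrable (flim μ) μ ∧ RootMeanTendsto γ f (∫ R, flim μ R ∂μ)

/-- For a family `f W` of functions on rooted graphs: the convergence in probability of the means
`𝔼_{v ∼ 𝒫_n}[f W (G_n, v) | G_n] → c W` is uniform in the parameter `W`. -/
def UniformRootMeanTendsto {p : ℕ} (γ : ∀ n, Measure (AttrGraph F 𝒴 ℰ (Fin n)))
    (f : Vec p → RootedGraph F 𝒴 ℰ → ℝ) (c : Vec p → ℝ) : Prop :=
  ∀ δ : ℝ, 0 < δ → ∀ᶠ n in atTop, ∀ W : Vec p,
    γ n {G | δ ≤ |rootMean (f W) G - c W|} ≤ ENNReal.ofReal δ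

/-- The loss of the limit GNN, `W ↦ 𝔼_{(G, o) ∼ μ}[L̃ W (G, o)]`, where `Llim W` is the limit
function of the loss with coefficients `W`. (For a loss depending only on a ball around the root
this limit function is the loss of the same GNN evaluated on the possibly infinite `(G, o)`; the
expectation does not depend on the choice of the limit function.) -/
def limitLoss {p : ℕ} (Llim : Vec p → Measure (RootedGraph F 𝒴 ℰ) → RootedGraph F 𝒴 ℰ → ℝ)
    (μ : Measure (RootedGraph F 𝒴 ℰ)) (W : Vec p) : ℝ :=
  ∫ R, Llim W μ R ∂μ

end Local

/-! ### Sampling-based GNNs -/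

/-- A computational graph for `L` layers on the vertex set `V`: `C ℓ v u` means that in layer `ℓ`
the connection from `u` to `v` is kept. (One fixed graph for all layers is the special case in
which `C` does not depend on `ℓ`.) -/
abbrev CompGraph (L : ℕ) (V : Type) : Type := Fin L → V → V → Prop

/-- The neighbours of `v` in `G` from which `v` aggregates in layer `ℓ` of the computational
graph `C`: the sampler can only prune connections of `G`. -/
def sampledNbrs {F L : ℕ} {𝒴 ℰ V : Type} (G : AttrGraph F 𝒴 ℰ V) (C : CompGraph L V)
    (ℓ : ℕ) (v : V) : Finset V :=
  ((G.finite_nbhd v).subset (fun _ hu => hu.1 :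
    {u | G.graph.Adj v u ∧ ∃ h : ℓ < L, C ⟨ℓ, h⟩ v u} ⊆ {u | G.graph.Adj v u})).toFinset

/-- A sampling-based GNN with `L` layers, `p` learning coefficients, layer widths `d ℓ` and
aggregate widths `a ℓ`. `AGGREGATE_ℓ` and `COMBINE_ℓ` act on embeddings and may in addition depend
on the graph and the node at which they are evaluated (through degrees, edge attributes, ...).
`sampler` is the computational graph sampler `ν_C`, a probability law on computational graphs for
each graph and node. `loss` is the loss at a node; it may use the attributes of the graph (labels)
and the matrix of output embeddings (as with negative sampling). -/
structure SamplingGNN (𝒴 ℰ : Type) [MeasurableSpace 𝒴] [MeasurableSpace ℰ]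
    (p : ℕ) (d a : ℕ → ℕ) (L : ℕ) where
  agg : (ℓ : ℕ) → Vec p → {V : Type} → AttrGraph (d 0) 𝒴 ℰ V → V → (S : Finset V) →
    (S → Vec (d ℓ)) → Vec (a ℓ)
  comb : (ℓ : ℕ) → Vec p → {V : Type} → AttrGraph (d 0) 𝒴 ℰ V → V →
    Vec (d ℓ) → Vec (a ℓ) → Vec (d (ℓ + 1))
  sampler : {V : Type} → AttrGraph (d 0) 𝒴 ℰ V → V → Measure (CompGraph L V)
  sampler_prob : ∀ {V : Type} (G : AttrGraph (d 0) 𝒴 ℰ V) (v : V),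
    IsProbabilityMeasure (sampler G v)
  sampler_meas : ∀ (n : ℕ) (v : Fin n),
    Measurable (fun G : AttrGraph (d 0) 𝒴 ℰ (Fin n) => sampler G v)
  loss : {V : Type} → AttrGraph (d 0) 𝒴 ℰ V → V → (V → Vec (d L)) → ℝ

/-- How the minibatch is drawn: `b` nodes drawn independently and uniformly (SGD), or all nodes. -/
inductive Batch where
  | iid (b : ℕ)
  | full

/-- The number of nodes in the minibatch of an `n`-node graph. -/
def Batch.size : Batch → ℕ → ℕ
  | .iid b, _ => b
  | .full, n => n

/-- The law of the `i`-th node of the minibatch. -/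
def Batch.nodeLaw : (B : Batch) → (n : ℕ) → Fin (B.size n) → Measure (Fin n)
  | .iid _, _, _ => uniformOn Set.univ
  | .full, _, i => Measure.dirac i

/-- The minibatch has at least `Y` nodes, or contains all nodes. -/
def Batch.LargeEnough (Y : ℕ) : Batch → Prop
  | .iid b => Y ≤ b
  | .full => True

namespace SamplingGNN

variable {𝒴 ℰ : Type} [MeasurableSpace 𝒴] [MeasurableSpace ℰ]
  {p : ℕ} {d a : ℕ → ℕ} {L : ℕ} (N : SamplingGNN 𝒴 ℰ p d a L)

/-- Forward propagation with coefficients `W` on the computational graph `C`: the embedding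
`h_v^{(ℓ)}`, with `h_v^{(0)} = x_v`. -/
def hidden (W : Vec p) {V : Type} (G : AttrGraph (d 0) 𝒴 ℰ V) (C : CompGraph L V) :
    (ℓ : ℕ) → V → Vec (d ℓ)
  | 0, v => G.x v
  | ℓ + 1, v =>
    N.comb ℓ W G v (hidden W G C ℓ v)
      (N.agg ℓ W G v (sampledNbrs G C ℓ v) (fun u => hidden W G C ℓ u))

/-- The loss at the node `v` of `G` when forward propagation uses the computational graph `C`. -/
def nodeLoss (W : Vec p) {V : Type} (G : AttrGraph (d 0) 𝒴 ℰ V) (v : V) (C : CompGraph L V) : ℝ :=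
  N.loss G v (N.hidden W G C L)

/-- The loss at the root, averaged over the computational graph sampler: the loss of the
sampling-based GNN with coefficients `W` as a function on rooted graphs. -/
def rootLoss (W : Vec p) (R : RootedGraph (d 0) 𝒴 ℰ) : ℝ :=
  ∫ C, N.nodeLoss W R.G R.root C ∂(N.sampler R.G R.root)

/-- The loss is a measurable function of the (finite) attributed graph. -/
def MeasurableLoss : Prop :=
  ∀ (n : ℕ) (v : Fin n) (C : CompGraph L (Fin n)) (W : Vec p),
    Measurable (fun G : AttrGraph (d 0) 𝒴 ℰ (Fin n) => N.nodeLoss W G v C)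

/-- On the sampled graphs the loss is bounded by `M`, and the loss and its gradient are Lipschitz
in the learning coefficients with constant `K`. -/
def RegularLoss (μS : ∀ n, Measure (AttrGraph (d 0) 𝒴 ℰ (Fin n))) (M : ℝ) (K : ℝ≥0) : Prop :=
  ∀ n, ∀ᵐ G ∂(μS n), ∀ (v : Fin n) (C : CompGraph L (Fin n)),
    (∀ W, |N.nodeLoss W G v C| ≤ M) ∧
    Differentiable ℝ (fun W => N.nodeLoss W G v C) ∧
    LipschitzWith K (fun W => N.nodeLoss W G v C) ∧
    LipschitzWith K (gradient (fun W => N.nodeLoss W G v C))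

/-! ### Training on sampled subgraphs -/

/-- What is sampled in one training step on `n`-node graphs with a minibatch of size `m`: the graph,
and for each member of the minibatch a node and its computational graph. -/
abbrev StepSample (_N : SamplingGNN 𝒴 ℰ p d a L) (n m : ℕ) : Type :=
  AttrGraph (d 0) 𝒴 ℰ (Fin n) × (Fin m → Fin n × CompGraph L (Fin n))

/-- The law of (node, computational graph) in the graph `G`: a node `v ∼ ρ`, and then
a computational graph drawn from `ν_C(G, v)`. -/
def nodeSampleLaw {n : ℕ} (ρ : Measure (Fin n)) (G : AttrGraph (d 0) 𝒴 ℰ (Fin n)) :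
    Measure (Fin n × CompGraph L (Fin n)) :=
  ρ.bind (fun v => Measure.map (fun C : CompGraph L (Fin n) => (v, C)) (N.sampler G v))

/-- The law of the sample of one training step: a graph `G` from the subgraph sampler and, given
`G`, the members of the minibatch independently of each other. -/
def stepLaw (μS : ∀ n, Measure (AttrGraph (d 0) 𝒴 ℰ (Fin n))) (n : ℕ) (B : Batch) :
    Measure (N.StepSample n (B.size n)) :=
  (μS n).bind (fun G =>
    Measure.map (fun s => (G, s))
      (Measure.pi (fun i => N.nodeSampleLaw (B.nodeLaw n i) G)))

/-- The minibatch gradient `1/|V_B| ∑_{v ∈ V_B} ∇_W ℒ(z_v)` (uniform node sampler, `ν_g = 1`). -/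
def batchGrad {n m : ℕ} (W : Vec p) (s : N.StepSample n m) : Vec p :=
  (m : ℝ)⁻¹ • ∑ i, gradient (fun W' => N.nodeLoss W' s.1 (s.2 i).1 (s.2 i).2) W

/-- The coefficients `W_t` of the training algorithm with learning rate `η`, initialization `W₀`
and step samples `ξ 0, ξ 1, ...`. -/
def weights {n m : ℕ} (η : ℝ) (W₀ : Vec p) (ξ : ℕ → N.StepSample n m) : ℕ → Vec p
  | 0 => W₀
  | t + 1 => weights η W₀ ξ t - η • N.batchGrad (weights η W₀ ξ t) (ξ t)

/-- `W₀ ∼ π₀` and `ξ 0, ξ 1, ... ∼ stepLaw` are independent random variables on `(Ω, P)`: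
the random input of a run of the training algorithm on `n`-node subgraphs. -/
structure IsRun (μS : ∀ n, Measure (AttrGraph (d 0) 𝒴 ℰ (Fin n))) (π₀ : Measure (Vec p))
    (n : ℕ) (B : Batch) {Ω : Type*} [MeasurableSpace Ω] (P : Measure Ω)
    (W₀ : Ω → Vec p) (ξ : ℕ → Ω → N.StepSample n (B.size n)) : Prop where
  measurable_init : Measurable W₀
  law_init : P.map W₀ = π₀
  measurable_sample : ∀ t, Measurable (ξ t)
  law_sample : ∀ t, P.map (ξ t) = N.stepLaw μS n B
  indep_samples : iIndepFun ξ P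
  indep_init : IndepFun W₀ (fun ω t => ξ t ω) P

end SamplingGNN

/-- The number of training steps along a trajectory `W` until `|∇ℓ(W_t)| ≤ ε` (`∞` if never). -/
def numSteps {p : ℕ} (ℓ : Vec p → ℝ) (ε : ℝ) (W : ℕ → Vec p) : ℝ≥0∞ :=
  ⨅ (t : ℕ) (_ : ‖gradient ℓ (W t)‖ ≤ ε), (t : ℝ≥0∞)

end

/-!
The mean loss `F_G(W)` of a sampled graph `G` is bounded, with bounded and Lipschitz gradient, for
almost every `G`. Encoded through a first-order Taylor estimate (`IsSmoothWith`), these properties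
are closed conditions on the values of the function and its gradient. They therefore pass to
averages (`IsSmoothWith.integral`) and to pointwise limits (`IsSmoothWith.exists_of_tendsto`).
Since `F_G(W)` converges in probability to the limit loss for every `W`, that is, along one filter
on pairs `(n, G)` (`inProbability`), the limit loss is smooth with the same constants, and in
particular differentiable.

The gradients converge too: between smooth functions, closeness of finitely many values implies
closeness of the gradients, by finite differences (`IsSmoothWith.norm_grad_sub_le`). Hence the mean
square distance between `∇F_G(W)` and the limit gradient tends to `0` for every `W`, uniformly on
balls because the gradients are equi-Lipschitz, and uniformly in `W` if the convergence of the
losses is. The minibatch gradient is an unbiased estimate of `∇F_G(W)` whose variance is at most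
`K² / |V_B|` (`integral_norm_mean_sub_sq_le`), so it estimates the limit gradient with small mean
square error for large graphs and large minibatches (`gradError_cutGrad_le`).

With `η K ≤ 1/2`, a step `W' = W - η v` satisfies
`η/2 |∇ℓ(W)|² ≤ ℓ(W) - ℓ(W') + η/2 |v - ∇ℓ(W)|²` (`IsSmoothWith.descent`). Summing along the
trajectory, stopped when the gradient gets small, and averaging each error over the fresh sample,
which is independent of the past, bounds the expected squared gradients by `4M/η` plus the expected
errors (`IsSmoothWith.sum_setLIntegral_grad_le`). All step counts follow. Without uniformity in `W`
only finitely many steps are controlled, since within them the coefficients remain in a fixed ball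
with high probability; with uniformity the error is absorbed at every step.

The gradient of the loss need not be measurable in the graph where the loss is not smooth. Training
is therefore compared with the iteration of `cutGrad`, which vanishes outside a measurable set of
full measure and is jointly measurable; the two agree almost surely.
-/

noncomputable section

/-! ### Smooth functions with bounded Lipschitz gradient -/

theorem EuclideanSpace.norm_le_sum_abs {p : ℕ} (u : EuclideanSpace ℝ (Fin p)) :
    ‖u‖ ≤ ∑ i, |u i| := by
  have hu : u = ∑ i, u i • EuclideanSpace.single i (1 : ℝ) := by
    ext j
    simp [Finset.sum_apply, Pi.single_apply]
  conv_lhs => rw [hu]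
  refine (norm_sum_le _ _).trans (le_of_eq ?_)
  simp [norm_smul]

section Smooth

open scoped RealInnerProductSpace

variable {E : Type*} [NormedAddCommGroup E] [InnerProductSpace ℝ E]

/-- `f` is bounded by `M` and has the gradient field `g`, which is bounded by `K` and
`K`-Lipschitz. Differentiability is encoded by the first-order Taylor estimate, so that every
clause is a closed condition on finitely many values of `f` and `g`: the notion is stable under
averaging and under pointwise limits. -/
structure IsSmoothWith (M K : ℝ) (f : E → ℝ) (g : E → E) : Prop where
  abs_le : ∀ W, |f W| ≤ M
  norm_grad_le : ∀ W, ‖g W‖ ≤ K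
  taylor : ∀ W W', |f W' - f W - ⟪g W, W' - W⟫| ≤ K * ‖W' - W‖ ^ 2
  lipschitz : ∀ W W', ‖g W' - g W‖ ≤ K * ‖W' - W‖

namespace IsSmoothWith

variable {M K : ℝ} {f : E → ℝ} {g : E → E}

theorem K_nonneg (h : IsSmoothWith M K f g) : 0 ≤ K :=
  (norm_nonneg _).trans (h.norm_grad_le 0)

theorem M_nonneg (h : IsSmoothWith M K f g) : 0 ≤ M :=
  (abs_nonneg _).trans (h.abs_le 0)

theorem hasGradientAt [CompleteSpace E] (h : IsSmoothWith M K f g) (W : E) :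
    HasGradientAt f (g W) W := by
  rw [hasGradientAt_iff_isLittleO]
  have hO : (fun W' => f W' - f W - ⟪g W, W' - W⟫) =O[𝓝 W] fun W' => ‖W' - W‖ ^ 2 := by
    refine Asymptotics.IsBigO.of_bound K (Eventually.of_forall fun W' => ?_)
    simpa using h.taylor W W'
  refine hO.trans_isLittleO ?_
  have := Asymptotics.isLittleO_norm_pow_id (E' := E) (n := 2) (by norm_num)
  have ht : Tendsto (fun W' : E => W' - W) (𝓝 W) (𝓝 0) := by
    have : Tendsto (fun W' : E => W' - W) (𝓝 W) (𝓝 (W - W)) := by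
      apply Continuous.tendsto; fun_prop
    simpa using this
  exact this.comp_tendsto ht

theorem gradient_eq [CompleteSpace E] (h : IsSmoothWith M K f g) : gradient f = g :=
  funext fun W => (h.hasGradientAt W).gradient

theorem differentiable [CompleteSpace E] (h : IsSmoothWith M K f g) : Differentiable ℝ f :=
  fun W => (h.hasGradientAt W).differentiableAt

theorem continuous_grad (h : IsSmoothWith M K f g) : Continuous g := by
  have : LipschitzWith K.toNNReal g := by
    refine LipschitzWith.of_dist_le_mul fun W W' => ?_
    rw [dist_eq_norm, dist_eq_norm, Real.coe_toNNReal _ h.K_nonneg]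
    exact h.lipschitz _ _
  exact this.continuous

/-- A bounded function with bounded Lipschitz gradient, by the mean value inequality. -/
theorem of_lipschitz [CompleteSpace E] {K : ℝ≥0} (hb : ∀ W, |f W| ≤ M) (hd : Differentiable ℝ f)
    (hl : LipschitzWith K f) (hg : LipschitzWith K (gradient f)) :
    IsSmoothWith M K f (gradient f) where
  abs_le := hb
  norm_grad_le W := by
    rw [gradient, LinearIsometryEquiv.norm_map]
    exact norm_fderiv_le_of_lipschitz ℝ hl
  lipschitz W W' := by
    simpa [dist_eq_norm] using hg.dist_le_mul W' W
  taylor W W' := by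
    have hin : ∀ x y, ⟪gradient f x, y⟫ = fderiv ℝ f x y := fun x y => by
      rw [gradient, InnerProductSpace.toDual_symm_apply]
    have hmem : ∀ x ∈ segment ℝ W W', ‖fderiv ℝ f x - fderiv ℝ f W‖ ≤ K * ‖W' - W‖ := by
      intro x hx
      have hn : ‖fderiv ℝ f x - fderiv ℝ f W‖ = ‖gradient f x - gradient f W‖ := by
        rw [gradient, gradient, ← map_sub, LinearIsometryEquiv.norm_map]
      rw [hn, ← dist_eq_norm]
      refine (hg.dist_le_mul x W).trans ?_
      gcongr
      rw [dist_eq_norm]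
      obtain ⟨t, ⟨h0, h1⟩, rfl⟩ := (segment_eq_image' ℝ W W' ▸ hx)
      rw [add_sub_cancel_left, norm_smul, Real.norm_of_nonneg h0]
      exact mul_le_of_le_one_left (norm_nonneg _) h1
    have := (convex_segment W W').norm_image_sub_le_of_norm_hasFDerivWithin_le'
      (f := f) (fun x _ => (hd x).hasFDerivAt.hasFDerivWithinAt) hmem
      (left_mem_segment ℝ W W') (right_mem_segment ℝ W W')
    rw [hin]
    calc _ ≤ _ := this
      _ = _ := by ring

/-- Averages of smooth functions are smooth. -/
theorem integral [CompleteSpace E] {Ω : Type*} [Finite Ω] [MeasurableSpace Ω]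
    [DiscreteMeasurableSpace Ω] (P : Measure Ω) [IsProbabilityMeasure P]
    {F : Ω → E → ℝ} {G : Ω → E → E} (h : ∀ ω, IsSmoothWith M K (F ω) (G ω)) :
    IsSmoothWith M K (fun W => ∫ ω, F ω W ∂P) (fun W => ∫ ω, G ω W ∂P) where
  abs_le W := by
    simpa using norm_integral_le_of_norm_le_const (μ := P) (f := fun ω => F ω W)
      (Eventually.of_forall fun ω => (h ω).abs_le W)
  norm_grad_le W := by
    simpa using norm_integral_le_of_norm_le_const (μ := P) (f := fun ω => G ω W)
      (Eventually.of_forall fun ω => (h ω).norm_grad_le W)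
  taylor W W' := by
    have he : (∫ ω, F ω W' ∂P) - (∫ ω, F ω W ∂P) - ⟪∫ ω, G ω W ∂P, W' - W⟫
        = ∫ ω, (F ω W' - F ω W - ⟪G ω W, W' - W⟫) ∂P := by
      have hi : ∫ ω, ⟪G ω W, W' - W⟫ ∂P = ⟪∫ ω, G ω W ∂P, W' - W⟫ := by
        simp_rw [real_inner_comm (W' - W)]
        exact integral_inner (𝕜 := ℝ) (Integrable.of_finite) _
      rw [integral_sub .of_finite .of_finite, integral_sub .of_finite .of_finite, hi]
    rw [he]
    simpa using norm_integral_le_of_norm_le_const (μ := P)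
      (f := fun ω => F ω W' - F ω W - ⟪G ω W, W' - W⟫)
      (Eventually.of_forall fun ω => (h ω).taylor W W')
  lipschitz W W' := by
    rw [← integral_sub .of_finite .of_finite]
    simpa using norm_integral_le_of_norm_le_const (μ := P)
      (f := fun ω => G ω W' - G ω W)
      (Eventually.of_forall fun ω => (h ω).lipschitz W W')

/-- Pointwise limits of smooth functions are smooth. The gradient of the limit is obtained from
compactness of the balls, as the limit of the gradients along an ultrafilter. -/
theorem exists_of_tendsto [ProperSpace E] {ι : Type*} {l : Filter ι} [l.NeBot]
    {F : ι → E → ℝ} {G : ι → E → E} (h : ∀ᶠ i in l, IsSmoothWith M K (F i) (G i))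
    (hf : ∀ W, Tendsto (fun i => F i W) l (𝓝 (f W))) : ∃ g, IsSmoothWith M K f g := by
  let U := Ultrafilter.of l
  have hU : (U : Filter ι) ≤ l := Ultrafilter.of_le l
  have h' : ∀ᶠ i in (U : Filter ι), IsSmoothWith M K (F i) (G i) := hU h
  have hf' : ∀ W, Tendsto (fun i => F i W) U (𝓝 (f W)) := fun W => (hf W).mono_left hU
  have hG : ∀ W, ∃ v, Tendsto (fun i => G i W) U (𝓝 v) := by
    intro W
    have hmem : Metric.closedBall (0 : E) K ∈ U.map (fun i => G i W) :=
      h'.mono fun i hi => by simpa using hi.norm_grad_le W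
    obtain ⟨v, -, hv⟩ := (isCompact_closedBall (0 : E) K).ultrafilter_le_nhds
      (U.map fun i => G i W) (le_principal_iff.2 hmem)
    exact ⟨v, hv⟩
  choose g hg using hG
  refine ⟨g, ?_, ?_, ?_, ?_⟩
  · exact fun W => le_of_tendsto (hf' W).abs (h'.mono fun i hi => hi.abs_le W)
  · exact fun W => le_of_tendsto (hg W).norm (h'.mono fun i hi => hi.norm_grad_le W)
  · exact fun W W' => le_of_tendsto
      (((hf' W').sub (hf' W)).sub ((hg W).inner tendsto_const_nhds)).abs
      (h'.mono fun i hi => hi.taylor W W')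
  · exact fun W W' => le_of_tendsto ((hg W').sub (hg W)).norm
      (h'.mono fun i hi => hi.lipschitz W W')

/-- One step of inexact gradient descent: completing the square in the Taylor estimate bounds the
decrease of `f` through the error `v - g W` of the gradient. -/
theorem descent (h : IsSmoothWith M K f g) {η : ℝ} (hη : 0 ≤ η) (hK : η * K ≤ 1 / 2) (W v : E) :
    η / 2 * ‖g W‖ ^ 2 ≤ f W - f (W - η • v) + η / 2 * ‖v - g W‖ ^ 2 := by
  have h1 := (_root_.abs_le.1 (h.taylor W (W - η • v))).2
  have h2 : W - η • v - W = -(η • v) := by abel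
  rw [h2, inner_neg_right, inner_smul_right, norm_neg, norm_smul, Real.norm_of_nonneg hη,
    mul_pow] at h1
  have h3 : ‖v - g W‖ ^ 2 = ‖v‖ ^ 2 - 2 * ⟪g W, v⟫ + ‖g W‖ ^ 2 := by
    rw [norm_sub_sq_real, real_inner_comm]
  have h4 : η * K * (η * ‖v‖ ^ 2) ≤ 1 / 2 * (η * ‖v‖ ^ 2) := by gcongr
  rw [h3]
  nlinarith

/-- Finite differences: two smooth functions that are close at `W` and at `W + h eᵢ` for all
coordinate directions `eᵢ` have close gradients at `W`. -/
theorem norm_grad_sub_le {p : ℕ} {f₁ f₂ : Vec p → ℝ} {g₁ g₂ : Vec p → Vec p}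
    (h₁ : IsSmoothWith M K f₁ g₁) (h₂ : IsSmoothWith M K f₂ g₂) {h δ : ℝ} (hh : 0 < h) (W : Vec p)
    (h0 : |f₁ W - f₂ W| ≤ δ)
    (hi : ∀ i, |f₁ (W + h • EuclideanSpace.single i 1) - f₂ (W + h • EuclideanSpace.single i 1)|
      ≤ δ) :
    ‖g₁ W - g₂ W‖ ≤ p * (2 * K * h + 2 * δ / h) := by
  refine (EuclideanSpace.norm_le_sum_abs _).trans ?_
  have : ∀ i, |(g₁ W - g₂ W) i| ≤ 2 * K * h + 2 * δ / h := by
    intro i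
    have t₁ := h₁.taylor W (W + h • EuclideanSpace.single i 1)
    have t₂ := h₂.taylor W (W + h • EuclideanSpace.single i 1)
    have hi := hi i
    simp only [add_sub_cancel_left, inner_smul_right, EuclideanSpace.inner_single_right, norm_smul,
      PiLp.norm_single, Real.norm_of_nonneg hh.le] at t₁ t₂
    simp at t₁ t₂
    rw [_root_.abs_le] at t₁ t₂ h0 hi
    have e : 2 * K * h + 2 * δ / h = (2 * K * h ^ 2 + 2 * δ) / h := by field_simp
    rw [e, le_div_iff₀ hh, ← abs_of_pos hh, ← abs_mul, abs_of_pos hh, _root_.abs_le]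
    simp only [PiLp.sub_apply]
    constructor <;> nlinarith
  calc _ ≤ ∑ _i : Fin p, (2 * K * h + 2 * δ / h) := Finset.sum_le_sum fun i _ => this i
    _ = _ := by rw [Finset.sum_const, Finset.card_univ, Fintype.card_fin, nsmul_eq_mul]

end IsSmoothWith

end Smooth

/-! ### Stochastic gradient descent with inexact gradients -/

section Independence

variable {Ω 𝒵 𝒳 𝒴 : Type*} [MeasurableSpace Ω] [MeasurableSpace 𝒵] [MeasurableSpace 𝒳]
  [MeasurableSpace 𝒴] {P : Measure Ω} [IsProbabilityMeasure P]

theorem IndepFun.prodMk_of_indepFun_prodMk {Z : Ω → 𝒵} {X : Ω → 𝒳} {Y : Ω → 𝒴}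
    (hZ : Measurable Z) (hX : Measurable X) (hY : Measurable Y)
    (h : IndepFun Z (fun ω => (X ω, Y ω)) P) (hXY : IndepFun X Y P) :
    IndepFun (fun ω => (Z ω, X ω)) Y P := by
  have hZX : IndepFun Z X P := h.comp measurable_id measurable_fst
  rw [indepFun_iff_map_prod_eq_prod_map_map (by fun_prop) (by fun_prop)] at h hXY hZX ⊢
  rw [hZX]
  rw [hXY] at h
  have hassoc : P.map (fun ω => ((Z ω, X ω), Y ω))
      = (P.map (fun ω => (Z ω, (X ω, Y ω)))).map MeasurableEquiv.prodAssoc.symm := by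
    rw [Measure.map_map (by fun_prop) (by fun_prop)]
    rfl
  have := Measure.isProbabilityMeasure_map (μ := P) hZ.aemeasurable
  have := Measure.isProbabilityMeasure_map (μ := P) hX.aemeasurable
  have := Measure.isProbabilityMeasure_map (μ := P) hY.aemeasurable
  rw [hassoc, h]
  exact ((measurePreserving_prodAssoc (P.map Z) (P.map X) (P.map Y)).symm
    MeasurableEquiv.prodAssoc).map_eq

/-- Conditioning on `Z` amounts to integrating out a variable independent of `Z`. -/
theorem lintegral_comp_of_indepFun {Z : Ω → 𝒵} {X : Ω → 𝒳} (hZ : Measurable Z) (hX : Measurable X)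
    (h : IndepFun Z X P) {H : 𝒵 × 𝒳 → ℝ≥0∞} (hH : Measurable H) :
    ∫⁻ ω, H (Z ω, X ω) ∂P = ∫⁻ ω, ∫⁻ x, H (Z ω, x) ∂(P.map X) ∂P := by
  have := Measure.isProbabilityMeasure_map (μ := P) hX.aemeasurable
  rw [indepFun_iff_map_prod_eq_prod_map_map (by fun_prop) (by fun_prop)] at h
  rw [← lintegral_map (f := H) hH (by fun_prop : Measurable fun ω => (Z ω, X ω)), h,
    lintegral_prod _ hH.aemeasurable, lintegral_map hH.lintegral_prod_right' hZ]

/-- What is known before step `t`: the initial value and the samples of the earlier steps. -/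
abbrev pastSigma {Ω 𝒵 𝒳 : Type*} [MeasurableSpace 𝒵] [MeasurableSpace 𝒳]
    (Z : Ω → 𝒵) (ξ : ℕ → Ω → 𝒳) (t : ℕ) : MeasurableSpace Ω :=
  MeasurableSpace.comap (fun ω => (Z ω, fun s : Finset.range t => ξ s ω)) inferInstance

theorem measurable_pastSigma_init {Ω 𝒵 𝒳 : Type*} [MeasurableSpace 𝒵] [MeasurableSpace 𝒳]
    (Z : Ω → 𝒵) (ξ : ℕ → Ω → 𝒳) (t : ℕ) :
    Measurable[pastSigma Z ξ t] Z :=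
  measurable_fst.comp (comap_measurable _)

theorem measurable_pastSigma_sample {Ω 𝒵 𝒳 : Type*} [MeasurableSpace 𝒵] [MeasurableSpace 𝒳]
    (Z : Ω → 𝒵) (ξ : ℕ → Ω → 𝒳) {s t : ℕ} (hs : s < t) :
    Measurable[pastSigma Z ξ t] (ξ s) :=
  (((measurable_pi_apply (⟨s, Finset.mem_range.2 hs⟩ : Finset.range t)).comp
    measurable_snd).comp
      (comap_measurable fun ω => (Z ω, fun s : Finset.range t => ξ s ω)) :)

theorem pastSigma_le {Z : Ω → 𝒵} {ξ : ℕ → Ω → 𝒳} (hZ : Measurable Z) (hξ : ∀ t, Measurable (ξ t))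
    (t : ℕ) : pastSigma Z ξ t ≤ ‹MeasurableSpace Ω› :=
  Measurable.comap_le (by fun_prop)

theorem indep_pastSigma {Z : Ω → 𝒵} {ξ : ℕ → Ω → 𝒳} (hZ : Measurable Z)
    (hξ : ∀ t, Measurable (ξ t)) (hi : iIndepFun ξ P) (h0 : IndepFun Z (fun ω t => ξ t ω) P)
    (t : ℕ) : Indep (pastSigma Z ξ t) (MeasurableSpace.comap (ξ t) inferInstance) P := by
  have h1 : IndepFun (fun ω (s : Finset.range t) => ξ s ω) (ξ t) P := by
    have := hi.indepFun_finset (Finset.range t) {t} (by simp) hξ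
    exact this.comp measurable_id (measurable_pi_apply (⟨t, by simp⟩ : ({t} : Finset ℕ)))
  have h2 : IndepFun Z (fun ω => ((fun s : Finset.range t => ξ s ω), ξ t ω)) P :=
    h0.comp (φ := id) (ψ := fun x : ℕ → 𝒳 => ((fun s : Finset.range t => x s), x t)) measurable_id
      (by fun_prop)
  exact IndepFun.prodMk_of_indepFun_prodMk hZ (by fun_prop) (hξ t) h2 h1

end Independence

section SGD

variable {E : Type*} [NormedAddCommGroup E] [InnerProductSpace ℝ E]

/-- The iterates `z_{t+1} = z_t - η Θ(z_t, x_t)` of stochastic gradient descent. -/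
def sgdIter {𝒳 : Type*} (η : ℝ) (Θ : E → 𝒳 → E) (z : E) (x : ℕ → 𝒳) : ℕ → E
  | 0 => z
  | t + 1 => sgdIter η Θ z x t - η • Θ (sgdIter η Θ z x t) (x t)

theorem norm_sgdIter_le {𝒳 : Type*} {η K : ℝ} (hη : 0 ≤ η) {Θ : E → 𝒳 → E}
    (hΘ : ∀ z x, ‖Θ z x‖ ≤ K) (z : E) (x : ℕ → 𝒳) (t : ℕ) :
    ‖sgdIter η Θ z x t‖ ≤ ‖z‖ + t * (η * K) := by
  induction t with
  | zero => simp [sgdIter]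
  | succ t ih =>
    have h1 : ‖η • Θ (sgdIter η Θ z x t) (x t)‖ ≤ η * K := by
      rw [norm_smul, Real.norm_of_nonneg hη]
      gcongr
      exact hΘ _ _
    rw [sgdIter]
    push_cast
    linarith [norm_sub_le (sgdIter η Θ z x t) (η • Θ (sgdIter η Θ z x t) (x t))]

theorem IsSmoothWith.sum_norm_grad_sq_le {M K : ℝ} {f : E → ℝ} {g : E → E}
    (h : IsSmoothWith M K f g) {𝒳 : Type*} {η : ℝ} (hη : 0 < η) (hK : η * K ≤ 1 / 2)
    (Θ : E → 𝒳 → E) (z : E) (x : ℕ → 𝒳) (k : ℕ) :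
    ∑ t ∈ Finset.range k, ‖g (sgdIter η Θ z x t)‖ ^ 2 ≤
      4 * M / η + ∑ t ∈ Finset.range k,
        ‖Θ (sgdIter η Θ z x t) (x t) - g (sgdIter η Θ z x t)‖ ^ 2 := by
  have key : ∀ k, η / 2 * ∑ t ∈ Finset.range k, ‖g (sgdIter η Θ z x t)‖ ^ 2 ≤
      f z - f (sgdIter η Θ z x k) + η / 2 * ∑ t ∈ Finset.range k,
        ‖Θ (sgdIter η Θ z x t) (x t) - g (sgdIter η Θ z x t)‖ ^ 2 := by
    intro k
    induction k with
    | zero => simp [sgdIter]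
    | succ k ih =>
      rw [Finset.sum_range_succ, Finset.sum_range_succ, mul_add, mul_add]
      have := h.descent hη.le hK (sgdIter η Θ z x k) (Θ (sgdIter η Θ z x k) (x k))
      rw [sgdIter]
      linarith
  have h1 := key k
  have h2 := (_root_.abs_le.1 (h.abs_le z)).2
  have h3 := (_root_.abs_le.1 (h.abs_le (sgdIter η Θ z x k))).1
  have h4 : η / 2 * (4 * M / η) = 2 * M := by field_simp; ring
  refine le_of_mul_le_mul_left ?_ (half_pos hη)
  rw [mul_add, h4]
  linarith

/-- The mean squared error of the stochastic gradient `Θ z x`, `x ∼ ν`, as an estimate of `g z`. -/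
def gradError {𝒳 : Type*} [MeasurableSpace 𝒳] (ν : Measure 𝒳) (Θ : E → 𝒳 → E) (g : E → E)
    (z : E) : ℝ≥0∞ :=
  ∫⁻ x, ENNReal.ofReal (‖Θ z x - g z‖ ^ 2) ∂ν

variable [MeasurableSpace E] [BorelSpace E] [SecondCountableTopology E]
  {𝒳 : Type*} [MeasurableSpace 𝒳]

theorem measurable_pastSigma_sgdIter {Ω : Type*} {η : ℝ} {Θ : E → 𝒳 → E}
    (hΘ : Measurable (Function.uncurry Θ)) (Z : Ω → E) (ξ : ℕ → Ω → 𝒳) {s t : ℕ} (hs : s ≤ t) :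
    Measurable[pastSigma Z ξ t] (fun ω => sgdIter η Θ (Z ω) (fun s => ξ s ω) s) := by
  induction s with
  | zero => exact measurable_pastSigma_init Z ξ t
  | succ s ih =>
    have ih := ih (by omega)
    have := measurable_pastSigma_sample Z ξ (t := t) (s := s) (by omega)
    exact ih.sub ((hΘ.comp (ih.prodMk this)).const_smul η)

/-- The initial value `Z` and the samples `ξ 0, ξ 1, ... ∼ ν` are independent: the random input of
stochastic gradient descent. -/
structure IsSGDInput {Ω : Type*} [MeasurableSpace Ω] (Z : Ω → E) (ξ : ℕ → Ω → 𝒳) (ν : Measure 𝒳)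
    (P : Measure Ω) : Prop where
  measurable_init : Measurable Z
  measurable_sample : ∀ t, Measurable (ξ t)
  law_sample : ∀ t, P.map (ξ t) = ν
  indep_samples : iIndepFun ξ P
  indep_init : IndepFun Z (fun ω t => ξ t ω) P

/-- Summed descent estimate, restricted to a decreasing sequence of events `A t` that are known
before step `t`. Since the sample of step `t` is independent of the past, its squared error may be
averaged before the trajectory is. -/
theorem IsSmoothWith.sum_setLIntegral_grad_le {M K : ℝ} {f : E → ℝ} {g : E → E}
    (h : IsSmoothWith M K f g) {η : ℝ} (hη : 0 < η) (hK : η * K ≤ 1 / 2) {Θ : E → 𝒳 → E}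
    (hΘ : Measurable (Function.uncurry Θ)) {Ω : Type*} [MeasurableSpace Ω]
    {P : Measure Ω} [IsProbabilityMeasure P] {ν : Measure 𝒳}
    {Z : Ω → E} {ξ : ℕ → Ω → 𝒳} (hin : IsSGDInput Z ξ ν P)
    {A : ℕ → Set Ω} (hA : Antitone A) (hAm : ∀ t, MeasurableSet[pastSigma Z ξ t] (A t)) (T : ℕ) :
    ∑ t ∈ Finset.range T,
        ∫⁻ ω in A t, ENNReal.ofReal (‖g (sgdIter η Θ (Z ω) (fun s => ξ s ω) t)‖ ^ 2) ∂P ≤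
      ENNReal.ofReal (4 * M / η) + ∑ t ∈ Finset.range T,
        ∫⁻ ω in A t, gradError ν Θ g (sgdIter η Θ (Z ω) (fun s => ξ s ω) t) ∂P := by
  classical
  obtain ⟨hZ, hξ, hν, hi, h0⟩ := hin
  set z : ℕ → Ω → E := fun t ω => sgdIter η Θ (Z ω) (fun s => ξ s ω) t with hz
  have hgm : Measurable g := h.continuous_grad.measurable
  have hzp : ∀ t, Measurable[pastSigma Z ξ t] (z t) := fun t =>
    measurable_pastSigma_sgdIter hΘ Z ξ le_rfl
  have hzm : ∀ t, Measurable (z t) := fun t => (hzp t).mono (pastSigma_le hZ hξ t) le_rfl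
  have hAm' : ∀ t, MeasurableSet (A t) := fun t => pastSigma_le hZ hξ t _ (hAm t)
  have hH : Measurable fun q : E × 𝒳 => ENNReal.ofReal (‖Θ q.1 q.2 - g q.1‖ ^ 2) := by
    have : Measurable fun q : E × 𝒳 => Θ q.1 q.2 := hΘ
    fun_prop
  -- conditioning on the past of step `t`
  have hcond : ∀ t, ∫⁻ ω in A t, gradError ν Θ g (z t ω) ∂P =
      ∫⁻ ω in A t, ENNReal.ofReal (‖Θ (z t ω) (ξ t ω) - g (z t ω)‖ ^ 2) ∂P := by
    intro t
    have hb : Measurable[pastSigma Z ξ t] ((A t).indicator (1 : Ω → ℝ≥0∞)) :=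
      Measurable.indicator measurable_const (hAm t)
    have hY : Measurable[pastSigma Z ξ t] fun ω => (z t ω, (A t).indicator (1 : Ω → ℝ≥0∞) ω) :=
      (hzp t).prodMk hb
    have hind : IndepFun (fun ω => (z t ω, (A t).indicator (1 : Ω → ℝ≥0∞) ω)) (ξ t) P :=
      indep_of_indep_of_le_left (indep_pastSigma hZ hξ hi h0 t) hY.comap_le
    have := lintegral_comp_of_indepFun (hY.mono (pastSigma_le hZ hξ t) le_rfl) (hξ t) hind
      (H := fun q => q.1.2 * ENNReal.ofReal (‖Θ q.1.1 q.2 - g q.1.1‖ ^ 2))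
      (by
        have := hH.comp (f := fun q : (E × ℝ≥0∞) × 𝒳 => (q.1.1, q.2)) (by fun_prop)
        exact (measurable_snd.comp measurable_fst).mul this)
    rw [hν t] at this
    rw [← lintegral_indicator (hAm' t), ← lintegral_indicator (hAm' t)]
    have e1 : ∀ u : Ω → ℝ≥0∞, (A t).indicator u = fun ω => (A t).indicator 1 ω * u ω := by
      intro u
      ext ω
      by_cases hω : ω ∈ A t <;> simp [hω]
    rw [e1 fun ω => gradError ν Θ g (z t ω),
      e1 fun ω => ENNReal.ofReal (‖Θ (z t ω) (ξ t ω) - g (z t ω)‖ ^ 2)]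
    refine Eq.trans ?_ this.symm
    refine lintegral_congr fun ω => ?_
    exact (lintegral_const_mul _ (hH.comp measurable_prodMk_left)).symm
  rw [Finset.sum_congr rfl fun t _ => hcond t]
  simp_rw [← lintegral_indicator (hAm' _)]
  have hm1 : ∀ t, Measurable fun ω => ENNReal.ofReal (‖g (z t ω)‖ ^ 2) := fun t => by
    have := hgm.comp (hzm t)
    exact (this.norm.pow_const 2).ennreal_ofReal
  have hm2 : ∀ t, Measurable fun ω => ENNReal.ofReal (‖Θ (z t ω) (ξ t ω) - g (z t ω)‖ ^ 2) :=
    fun t => hH.comp ((hzm t).prodMk (hξ t))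
  rw [← lintegral_finsetSum _ fun t _ => (hm1 t).indicator (hAm' t),
    ← lintegral_finsetSum _ fun t _ => (hm2 t).indicator (hAm' t)]
  have hc : ENNReal.ofReal (4 * M / η) = ∫⁻ _, ENNReal.ofReal (4 * M / η) ∂P := by simp
  rw [hc, ← lintegral_add_left measurable_const]
  refine lintegral_mono fun ω => ?_
  -- the sum over the steps with `ω ∈ A t` is a sum over an initial segment
  obtain ⟨k, hk⟩ : ∃ k, (Finset.range T).filter (fun t => ω ∈ A t) = Finset.range k := by
    induction T with
    | zero => exact ⟨0, rfl⟩
    | succ T ih =>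
      by_cases hT : ω ∈ A T
      · refine ⟨T + 1, Finset.filter_true_of_mem fun t ht => ?_⟩
        exact hA (Nat.lt_succ_iff.1 (Finset.mem_range.1 ht)) hT
      · obtain ⟨k, hk⟩ := ih
        exact ⟨k, by rw [Finset.range_add_one, Finset.filter_insert, if_neg hT, hk]⟩
  have e2 : ∀ u : ℕ → Ω → ℝ, (∀ t, 0 ≤ u t ω) → ∑ t ∈ Finset.range T,
      (A t).indicator (fun ω => ENNReal.ofReal (u t ω)) ω
        = ENNReal.ofReal (∑ t ∈ Finset.range k, u t ω) := by
    intro u hu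
    rw [ENNReal.ofReal_sum_of_nonneg fun t _ => hu t, ← hk, Finset.sum_filter]
    rfl
  have hM := h.M_nonneg
  rw [e2 (fun t ω => ‖g (z t ω)‖ ^ 2) fun t => by positivity,
    e2 (fun t ω => ‖Θ (z t ω) (ξ t ω) - g (z t ω)‖ ^ 2) fun t => by positivity,
    ← ENNReal.ofReal_add (by positivity) (Finset.sum_nonneg fun t _ => by positivity)]
  exact ENNReal.ofReal_le_ofReal (h.sum_norm_grad_sq_le hη hK Θ (Z ω) (fun s => ξ s ω) k)

end SGD

/-! ### Counting the steps before the gradient is small -/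

section Steps

variable {p : ℕ} {Ω : Type*}

/-- The event that none of the first `t + 1` iterates has a gradient of norm at most `ε`. -/
def notReached (g : Vec p → Vec p) (ε : ℝ) (z : ℕ → Ω → Vec p) (t : ℕ) : Set Ω :=
  {ω | ∀ s ≤ t, ε < ‖g (z s ω)‖}

theorem antitone_notReached (g : Vec p → Vec p) (ε : ℝ) (z : ℕ → Ω → Vec p) :
    Antitone (notReached g ε z) :=
  fun _ _ hst _ hω r hr => hω r (hr.trans hst)

theorem measurableSet_notReached {m : MeasurableSpace Ω} {g : Vec p → Vec p} (hg : Measurable g)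
    (ε : ℝ) {z : ℕ → Ω → Vec p} {t : ℕ} (hz : ∀ s ≤ t, Measurable (z s)) :
    MeasurableSet (notReached g ε z t) := by
  simp only [notReached, Set.ofPred_forall]
  exact MeasurableSet.iInter fun s => MeasurableSet.iInter fun hs =>
    measurableSet_lt measurable_const (hg.comp (hz s hs)).norm

theorem min_numSteps_le_sum (f : Vec p → ℝ) (ε : ℝ) (z : ℕ → Ω → Vec p) (ω : Ω) (T : ℕ) :
    min (numSteps f ε fun t => z t ω) T ≤
      ∑ t ∈ Finset.range T, (notReached (gradient f) ε z t).indicator 1 ω := by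
  induction T with
  | zero => simp
  | succ T ih =>
    rw [Finset.sum_range_succ]
    by_cases hT : ω ∈ notReached (gradient f) ε z T
    · rw [Set.indicator_of_mem hT]
      calc min (numSteps f ε fun t => z t ω) ((T + 1 : ℕ) : ℝ≥0∞)
          ≤ min (numSteps f ε fun t => z t ω) T + 1 := by
            rw [← min_add_add_right]
            push_cast
            exact min_le_min le_self_add le_rfl
        _ ≤ _ := by gcongr; rfl
    · rw [Set.indicator_of_notMem hT, add_zero]
      refine le_trans (le_min (min_le_left _ _) ?_) ih
      simp only [notReached, Set.mem_ofPred_eq, not_forall, not_lt] at hT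
      obtain ⟨s, hs, hle⟩ := hT
      refine (min_le_left _ _).trans ((iInf₂_le s hle).trans ?_)
      exact_mod_cast hs

theorem numSteps_le_tsum (f : Vec p → ℝ) (ε : ℝ) (z : ℕ → Ω → Vec p) (ω : Ω) :
    numSteps f ε (fun t => z t ω) ≤
      ∑' t, (notReached (gradient f) ε z t).indicator (1 : Ω → ℝ≥0∞) ω := by
  have h : ∀ T : ℕ, min (numSteps f ε fun t => z t ω) T ≤
      ∑' t, (notReached (gradient f) ε z t).indicator (1 : Ω → ℝ≥0∞) ω := fun T =>
    (min_numSteps_le_sum f ε z ω T).trans (ENNReal.sum_le_tsum _)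
  have ht : Tendsto (fun T : ℕ => min (numSteps f ε fun t => z t ω) (T : ℝ≥0∞)) atTop
      (𝓝 (min (numSteps f ε fun t => z t ω) ⊤)) :=
    tendsto_const_nhds.min ENNReal.tendsto_nat_nhds_top
  rw [min_top_right] at ht
  exact le_of_tendsto' ht h

section Complexity

variable {𝒳 : Type*} [MeasurableSpace 𝒳] [MeasurableSpace Ω] {M K : ℝ} {f : Vec p → ℝ}
  {g : Vec p → Vec p} {η : ℝ} {Θ : Vec p → 𝒳 → Vec p} {P : Measure Ω}
  {ν : Measure 𝒳} {Z : Ω → Vec p} {ξ : ℕ → Ω → 𝒳}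

theorem IsSGDInput.measurable_sgdIter (hin : IsSGDInput Z ξ ν P)
    (hΘ : Measurable (Function.uncurry Θ)) (t : ℕ) :
    Measurable fun ω => sgdIter η Θ (Z ω) (fun s => ξ s ω) t :=
  (measurable_pastSigma_sgdIter hΘ Z ξ le_rfl).mono
    (pastSigma_le hin.measurable_init hin.measurable_sample t) le_rfl

theorem IsSmoothWith.measurableSet_notReached_sgdIter (h : IsSmoothWith M K f g)
    (hΘ : Measurable (Function.uncurry Θ)) (hin : IsSGDInput Z ξ ν P) (ε : ℝ) (t : ℕ) :
    MeasurableSet (notReached g ε (fun t ω => sgdIter η Θ (Z ω) (fun s => ξ s ω) t) t) :=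
  measurableSet_notReached h.continuous_grad.measurable ε fun s _ =>
    hin.measurable_sgdIter hΘ s

variable [IsProbabilityMeasure P]

/-- If the expected gradient error is at most `ε² / 2`, then among any number larger than `2c / ε²`
of initial steps, where `c = 4 M / η`, there is one with a gradient of expected norm at most `ε`:
otherwise the expected squared norm would be more than `ε²` at each of them. -/
theorem IsSmoothWith.exists_lintegral_norm_grad_le (h : IsSmoothWith M K f g) (hη : 0 < η)
    (hK : η * K ≤ 1 / 2) (hΘ : Measurable (Function.uncurry Θ)) (hin : IsSGDInput Z ξ ν P)
    {ε : ℝ} (hε : 0 < ε) {T : ℕ} (hT : 2 * (4 * M / η) < T * ε ^ 2)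
    (herr : ∀ t < T, ∫⁻ ω, gradError ν Θ g (sgdIter η Θ (Z ω) (fun s => ξ s ω) t) ∂P ≤
      ENNReal.ofReal (ε ^ 2 / 2)) :
    ∃ t < T, ∫⁻ ω, ‖g (sgdIter η Θ (Z ω) (fun s => ξ s ω) t)‖ₑ ∂P ≤ ENNReal.ofReal ε := by
  by_contra! hcon
  have hM := h.M_nonneg
  have hsq : ∀ t < T, ENNReal.ofReal (ε ^ 2) ≤
      ∫⁻ ω, ENNReal.ofReal (‖g (sgdIter η Θ (Z ω) (fun s => ξ s ω) t)‖ ^ 2) ∂P := by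
    intro t ht
    by_contra! hlt
    refine (hcon t ht).not_ge ?_
    -- `x ≤ x² / (2 ε) + ε / 2`
    have hpt : ∀ ω, ‖g (sgdIter η Θ (Z ω) (fun s => ξ s ω) t)‖ₑ ≤ ENNReal.ofReal (ε / 2) +
        ENNReal.ofReal (1 / (2 * ε)) *
          ENNReal.ofReal (‖g (sgdIter η Θ (Z ω) (fun s => ξ s ω) t)‖ ^ 2) := by
      intro ω
      rw [← ofReal_norm, ← ENNReal.ofReal_mul (by positivity),
        ← ENNReal.ofReal_add (by positivity) (by positivity)]
      refine ENNReal.ofReal_le_ofReal ?_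
      set x := ‖g (sgdIter η Θ (Z ω) (fun s => ξ s ω) t)‖
      have : ε / 2 + 1 / (2 * ε) * x ^ 2 - x = (x - ε) ^ 2 / (2 * ε) := by field_simp; ring
      have : 0 ≤ (x - ε) ^ 2 / (2 * ε) := by positivity
      linarith
    refine (lintegral_mono hpt).trans ?_
    rw [lintegral_add_left measurable_const, lintegral_const_mul' _ _ ENNReal.ofReal_ne_top]
    simp only [lintegral_const, measure_univ, mul_one]
    calc _ ≤ ENNReal.ofReal (ε / 2) + ENNReal.ofReal (1 / (2 * ε)) * ENNReal.ofReal (ε ^ 2) := by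
          gcongr
      _ = ENNReal.ofReal ε := by
          rw [← ENNReal.ofReal_mul (by positivity),
            ← ENNReal.ofReal_add (by positivity) (by positivity)]
          congr 1
          field_simp
          ring
  have hmain := h.sum_setLIntegral_grad_le hη hK hΘ hin (A := fun _ => Set.univ)
    (fun _ _ _ => le_rfl) (fun _ => MeasurableSet.univ) T
  simp only [Measure.restrict_univ] at hmain
  have h1 : (T : ℝ≥0∞) * ENNReal.ofReal (ε ^ 2) ≤
      ENNReal.ofReal (4 * M / η) + T * ENNReal.ofReal (ε ^ 2 / 2) := by
    calc (T : ℝ≥0∞) * ENNReal.ofReal (ε ^ 2)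
        = ∑ _t ∈ Finset.range T, ENNReal.ofReal (ε ^ 2) := by simp
      _ ≤ _ := Finset.sum_le_sum fun t ht => hsq t (Finset.mem_range.1 ht)
      _ ≤ _ := hmain
      _ ≤ ENNReal.ofReal (4 * M / η) + ∑ _t ∈ Finset.range T, ENNReal.ofReal (ε ^ 2 / 2) := by
          gcongr with t ht
          exact herr t (Finset.mem_range.1 ht)
      _ = _ := by simp
  rw [← ENNReal.ofReal_natCast, ← ENNReal.ofReal_mul (by positivity),
    ← ENNReal.ofReal_mul (by positivity), ← ENNReal.ofReal_add (by positivity) (by positivity),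
    ENNReal.ofReal_le_ofReal_iff (by positivity)] at h1
  linarith

/-- The expected number of steps with large gradient, times `ε²`, is controlled by the gradient
error collected before the gradient is small. -/
theorem IsSmoothWith.sum_measure_notReached_le (h : IsSmoothWith M K f g) (hη : 0 < η)
    (hK : η * K ≤ 1 / 2) (hΘ : Measurable (Function.uncurry Θ)) (hin : IsSGDInput Z ξ ν P)
    {ε : ℝ} (hε : 0 < ε) (T : ℕ) :
    ENNReal.ofReal (ε ^ 2) * ∑ t ∈ Finset.range T,
        P (notReached g ε (fun t ω => sgdIter η Θ (Z ω) (fun s => ξ s ω) t) t) ≤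
      ENNReal.ofReal (4 * M / η) + ∑ t ∈ Finset.range T,
        ∫⁻ ω in notReached g ε (fun t ω => sgdIter η Θ (Z ω) (fun s => ξ s ω) t) t,
          gradError ν Θ g (sgdIter η Θ (Z ω) (fun s => ξ s ω) t) ∂P := by
  have hA : ∀ t, MeasurableSet[pastSigma Z ξ t]
      (notReached g ε (fun t ω => sgdIter η Θ (Z ω) (fun s => ξ s ω) t) t) := fun t =>
    measurableSet_notReached h.continuous_grad.measurable ε fun s hs =>
      measurable_pastSigma_sgdIter hΘ Z ξ hs
  refine le_trans ?_ (h.sum_setLIntegral_grad_le hη hK hΘ hin (antitone_notReached g ε _) hA T)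
  rw [Finset.mul_sum]
  refine Finset.sum_le_sum fun t _ => ?_
  rw [← setLIntegral_const]
  refine setLIntegral_mono' (pastSigma_le hin.measurable_init hin.measurable_sample t _ (hA t))
    fun ω hω => ENNReal.ofReal_le_ofReal ?_
  have := (hω t le_rfl).le
  gcongr

/-- Capped number of steps, when the total expected gradient error up to the cap is at most `1`. -/
theorem IsSmoothWith.lintegral_min_numSteps_le (h : IsSmoothWith M K f g) (hη : 0 < η)
    (hK : η * K ≤ 1 / 2) (hΘ : Measurable (Function.uncurry Θ)) (hin : IsSGDInput Z ξ ν P)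
    {ε : ℝ} (hε : 0 < ε) {T : ℕ}
    (herr : ∑ t ∈ Finset.range T,
      ∫⁻ ω, gradError ν Θ g (sgdIter η Θ (Z ω) (fun s => ξ s ω) t) ∂P ≤ 1) :
    ∫⁻ ω, min (numSteps f ε (sgdIter η Θ (Z ω) (fun s => ξ s ω))) T ∂P ≤
      ENNReal.ofReal ((4 * M / η + 1) / ε ^ 2) := by
  have hM := h.M_nonneg
  have hA := h.measurableSet_notReached_sgdIter (η := η) hΘ hin ε
  refine (lintegral_mono fun ω => min_numSteps_le_sum f ε
    (fun t ω => sgdIter η Θ (Z ω) (fun s => ξ s ω) t) ω T).trans ?_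
  rw [h.gradient_eq, lintegral_finsetSum _ fun t _ => measurable_one.indicator (hA t)]
  simp_rw [lintegral_indicator_one (hA _)]
  rw [ENNReal.ofReal_div_of_pos (by positivity), ENNReal.le_div_iff_mul_le
    (Or.inl (by simpa using hε.ne')) (Or.inl ENNReal.ofReal_ne_top), mul_comm,
    ENNReal.ofReal_add (by positivity) zero_le_one, ENNReal.ofReal_one]
  refine (h.sum_measure_notReached_le hη hK hΘ hin hε T).trans ?_
  gcongr
  refine le_trans (Finset.sum_le_sum fun t _ => ?_) herr
  exact setLIntegral_le_lintegral _ _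

/-- Number of steps, when the gradient error is at most `ε² / 2` everywhere: while the gradient is
larger than `ε`, the error is absorbed in half of the decrease. -/
theorem IsSmoothWith.lintegral_numSteps_le (h : IsSmoothWith M K f g) (hη : 0 < η)
    (hK : η * K ≤ 1 / 2) (hΘ : Measurable (Function.uncurry Θ)) (hin : IsSGDInput Z ξ ν P)
    {ε : ℝ} (hε : 0 < ε) (herr : ∀ W, gradError ν Θ g W ≤ ENNReal.ofReal (ε ^ 2 / 2)) :
    ∫⁻ ω, numSteps f ε (sgdIter η Θ (Z ω) (fun s => ξ s ω)) ∂P ≤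
      ENNReal.ofReal (2 * (4 * M / η) / ε ^ 2) := by
  have hM := h.M_nonneg
  have hA := h.measurableSet_notReached_sgdIter (η := η) hΘ hin ε
  refine (lintegral_mono fun ω => numSteps_le_tsum f ε
    (fun t ω => sgdIter η Θ (Z ω) (fun s => ξ s ω) t) ω).trans ?_
  rw [h.gradient_eq, lintegral_tsum fun t => (measurable_one.indicator (hA t)).aemeasurable]
  simp_rw [lintegral_indicator_one (hA _)]
  refine ENNReal.tsum_le_of_sum_range_le fun T => ?_
  have hmain := h.sum_measure_notReached_le hη hK hΘ hin hε T
  have hle : ∀ t, ∫⁻ ω in notReached g ε (fun t ω => sgdIter η Θ (Z ω) (fun s => ξ s ω) t) t,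
      gradError ν Θ g (sgdIter η Θ (Z ω) (fun s => ξ s ω) t) ∂P ≤ ENNReal.ofReal (ε ^ 2 / 2) *
        P (notReached g ε (fun t ω => sgdIter η Θ (Z ω) (fun s => ξ s ω) t) t) := fun t => by
    rw [← setLIntegral_const]
    exact lintegral_mono fun ω => herr _
  replace hmain := hmain.trans (add_le_add_right (Finset.sum_le_sum fun t _ => hle t) _)
  rw [← Finset.mul_sum] at hmain
  set x := ∑ t ∈ Finset.range T,
    P (notReached g ε (fun t ω => sgdIter η Θ (Z ω) (fun s => ξ s ω) t) t)
  have hx : x ≠ ⊤ := ENNReal.sum_ne_top.2 fun t _ => measure_ne_top _ _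
  rw [← ENNReal.ofReal_toReal hx, ← ENNReal.ofReal_mul (by positivity),
    ← ENNReal.ofReal_mul (by positivity), ← ENNReal.ofReal_add (by positivity) (by positivity),
    ENNReal.ofReal_le_ofReal_iff (by positivity)] at hmain
  rw [← ENNReal.ofReal_toReal hx]
  refine ENNReal.ofReal_le_ofReal ?_
  rw [le_div_iff₀ (by positivity)]
  linarith

end Complexity

end Steps

/-! ### Variance of minibatch means -/

/-- The mean squared error of the mean of `m` independent vectors of norm at most `K` is at most
`K² / m` plus the squared bias. -/
theorem integral_norm_mean_sub_sq_le {p m : ℕ} (hm : 0 < m) {α : Type*} [Finite α]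
    [MeasurableSpace α] [DiscreteMeasurableSpace α] (ρ : Fin m → Measure α)
    [∀ i, IsProbabilityMeasure (ρ i)] {K : ℝ} (X : α → Vec p) (hX : ∀ a, ‖X a‖ ≤ K) (c : Vec p) :
    ∫ s, ‖(m : ℝ)⁻¹ • ∑ i, X (s i) - c‖ ^ 2 ∂(Measure.pi ρ) ≤
      K ^ 2 / m + ‖(m : ℝ)⁻¹ • ∑ i, ∫ a, X a ∂(ρ i) - c‖ ^ 2 := by
  have hm' : (0 : ℝ) < m := by exact_mod_cast hm
  have hcoord : ∀ (i : Fin m) (j : Fin p), (∫ a, X a ∂(ρ i)) j = ∫ a, X a j ∂(ρ i) := fun i j =>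
    (ContinuousLinearMap.integral_comp_comm (EuclideanSpace.proj (𝕜 := ℝ) j)
      (Integrable.of_finite (f := X) (μ := ρ i))).symm
  -- bias-variance decomposition of a single coordinate
  have hvar : ∀ j : Fin p,
      ∫ s, ((m : ℝ)⁻¹ * ∑ i, X (s i) j - c j) ^ 2 ∂(Measure.pi ρ) ≤
        (m : ℝ)⁻¹ ^ 2 * ∑ i, ∫ a, X a j ^ 2 ∂(ρ i) +
          ((m : ℝ)⁻¹ * ∑ i, ∫ a, X a j ∂(ρ i) - c j) ^ 2 := by
    intro j
    set Y : (Fin m → α) → ℝ := fun s => (m : ℝ)⁻¹ * ∑ i, X (s i) j with hY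
    have hmem : MemLp (fun s => Y s - c j) 2 (Measure.pi ρ) := MemLp.of_discrete
    have hV : Var[fun s => Y s - c j; Measure.pi ρ]
        ≤ (m : ℝ)⁻¹ ^ 2 * ∑ i, ∫ a, X a j ^ 2 ∂(ρ i) := by
      rw [variance_sub_const (Measurable.of_discrete.aestronglyMeasurable), hY,
        variance_const_mul]
      gcongr
      have h1 : (fun s : Fin m → α => ∑ i, X (s i) j)
          = ∑ i, fun s : Fin m → α => (fun a => X a j) (s i) := by
        ext s; simp
      rw [h1, variance_sum_pi (X := fun (_ : Fin m) (a : α) => X a j) fun i => MemLp.of_discrete]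
      exact Finset.sum_le_sum fun i _ =>
        variance_le_expectation_sq Measurable.of_discrete.aestronglyMeasurable
    have hE : ∫ s, (Y s - c j) ∂(Measure.pi ρ) = (m : ℝ)⁻¹ * ∑ i, ∫ a, X a j ∂(ρ i) - c j := by
      rw [integral_sub .of_finite .of_finite, hY, integral_const_mul,
        integral_finsetSum _ fun i _ => .of_finite]
      congr 2
      · refine Finset.sum_congr rfl fun i _ => ?_
        exact integral_comp_eval (X := fun _ : Fin m => α) (μ := ρ) (f := fun a => X a j)
          Measurable.of_discrete.aestronglyMeasurable
      · simp
    rw [variance_eq_sub hmem, hE] at hV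
    simp only [Pi.pow_apply] at hV
    linarith
  have hsq : ∀ i, ∑ j, ∫ a, X a j ^ 2 ∂(ρ i) ≤ K ^ 2 := by
    intro i
    rw [← integral_finsetSum _ fun j _ => .of_finite]
    have : ∫ a, ∑ j, X a j ^ 2 ∂(ρ i) ≤ ∫ _, K ^ 2 ∂(ρ i) :=
      integral_mono .of_finite .of_finite fun a => by
        change ∑ j, X a j ^ 2 ≤ K ^ 2
        rw [← EuclideanSpace.real_norm_sq_eq]
        have := hX a
        gcongr
    simpa using this
  simp_rw [EuclideanSpace.real_norm_sq_eq]
  rw [integral_finsetSum _ fun j _ => .of_finite]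
  have hL : ∀ j : Fin p, ∫ s, ((m : ℝ)⁻¹ • ∑ i, X (s i) - c) j ^ 2 ∂(Measure.pi ρ)
      = ∫ s, ((m : ℝ)⁻¹ * ∑ i, X (s i) j - c j) ^ 2 ∂(Measure.pi ρ) := by
    intro j; simp
  have hR : ∀ j : Fin p, ((m : ℝ)⁻¹ • ∑ i, ∫ a, X a ∂(ρ i) - c) j
      = (m : ℝ)⁻¹ * ∑ i, ∫ a, X a j ∂(ρ i) - c j := by
    intro j; simp [hcoord]
  simp_rw [hL, hR]
  refine (Finset.sum_le_sum fun j _ => hvar j).trans ?_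
  rw [Finset.sum_add_distrib, ← Finset.mul_sum, Finset.sum_comm]
  gcongr
  calc (m : ℝ)⁻¹ ^ 2 * ∑ i, ∑ j, ∫ a, X a j ^ 2 ∂(ρ i)
      ≤ (m : ℝ)⁻¹ ^ 2 * ∑ _i : Fin m, K ^ 2 := by
        gcongr with i
        exact hsq i
    _ = K ^ 2 / m := by
        rw [Finset.sum_const, Finset.card_univ, Fintype.card_fin, nsmul_eq_mul]
        field_simp

theorem integral_uniformOn_univ_fin {n : ℕ} {E : Type*} [NormedAddCommGroup E]
    [NormedSpace ℝ E] [CompleteSpace E] (f : Fin n → E) :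
    ∫ v, f v ∂(uniformOn Set.univ) = (n : ℝ)⁻¹ • ∑ v, f v := by
  rcases Nat.eq_zero_or_pos n with rfl | hn
  · have : uniformOn (Set.univ : Set (Fin 0)) = 0 := by
      ext s; simp [Set.eq_empty_of_isEmpty s]
    simp [this]
  · have : NeZero n := ⟨hn.ne'⟩
    rw [integral_fintype .of_finite, Finset.smul_sum]
    refine Finset.sum_congr rfl fun v _ => ?_
    congr 1
    rw [measureReal_def, uniformOn_univ]
    simp

namespace SamplingGNN

/-! ### The law of one training step -/

variable {𝒴 ℰ : Type} [MeasurableSpace 𝒴] [MeasurableSpace ℰ]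
  {p : ℕ} {d a : ℕ → ℕ} {L : ℕ} (N : SamplingGNN 𝒴 ℰ p d a L)

instance {V : Type} (G : AttrGraph (d 0) 𝒴 ℰ V) (v : V) : IsProbabilityMeasure (N.sampler G v) :=
  N.sampler_prob G v

instance (B : Batch) (n : ℕ) [NeZero n] (i : Fin (B.size n)) :
    IsProbabilityMeasure (B.nodeLaw n i) := by
  cases B with
  | iid b => exact inferInstanceAs (IsProbabilityMeasure (uniformOn (Set.univ : Set (Fin n))))
  | full => exact inferInstanceAs (IsProbabilityMeasure (Measure.dirac i))

/-- The computational graph sampler of a finite graph as a kernel from nodes. -/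
def samplerKernel {n : ℕ} (G : AttrGraph (d 0) 𝒴 ℰ (Fin n)) :
    Kernel (Fin n) (CompGraph L (Fin n)) :=
  ⟨fun v => N.sampler G v, Measurable.of_discrete⟩

instance {n : ℕ} (G : AttrGraph (d 0) 𝒴 ℰ (Fin n)) : IsMarkovKernel (N.samplerKernel G) :=
  ⟨fun v => N.sampler_prob G v⟩

theorem nodeSampleLaw_eq_compProd {n : ℕ} (ρ : Measure (Fin n)) [IsFiniteMeasure ρ]
    (G : AttrGraph (d 0) 𝒴 ℰ (Fin n)) :
    N.nodeSampleLaw ρ G = ρ ⊗ₘ N.samplerKernel G := by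
  ext s hs
  rw [nodeSampleLaw, Measure.bind_apply hs Measurable.of_discrete.aemeasurable,
    Measure.compProd_apply hs]
  exact lintegral_congr fun v => Measure.map_apply measurable_prodMk_left hs

instance {n : ℕ} (ρ : Measure (Fin n)) [IsProbabilityMeasure ρ]
    (G : AttrGraph (d 0) 𝒴 ℰ (Fin n)) : IsProbabilityMeasure (N.nodeSampleLaw ρ G) := by
  rw [nodeSampleLaw_eq_compProd]; infer_instance

theorem integral_nodeSampleLaw {n : ℕ} (ρ : Measure (Fin n)) [IsProbabilityMeasure ρ]
    (G : AttrGraph (d 0) 𝒴 ℰ (Fin n)) {E : Type*} [NormedAddCommGroup E] [NormedSpace ℝ E]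
    (f : Fin n × CompGraph L (Fin n) → E) :
    ∫ q, f q ∂(N.nodeSampleLaw ρ G) = ∫ v, ∫ C, f (v, C) ∂(N.sampler G v) ∂ρ := by
  rw [nodeSampleLaw_eq_compProd, Measure.integral_compProd .of_finite]
  rfl

theorem measurable_nodeSampleLaw {n : ℕ} (ρ : Measure (Fin n)) [IsFiniteMeasure ρ] :
    Measurable (N.nodeSampleLaw ρ) := by
  refine Measure.measurable_of_measurable_coe _ fun s hs => ?_
  simp_rw [nodeSampleLaw_eq_compProd, Measure.compProd_apply hs, lintegral_fintype]
  refine Finset.measurable_sum _ fun v _ => Measurable.mul_const ?_ _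
  exact (Measure.measurable_coe (measurable_prodMk_left hs)).comp (N.sampler_meas n v)

/-- The conditional law of the minibatch given the sampled graph. -/
def batchKernel (n : ℕ) [NeZero n] (B : Batch) :
    Kernel (AttrGraph (d 0) 𝒴 ℰ (Fin n)) (Fin (B.size n) → Fin n × CompGraph L (Fin n)) where
  toFun G := Measure.pi fun i => N.nodeSampleLaw (B.nodeLaw n i) G
  measurable' := by
    refine Measure.measurable_of_measurable_coe _ fun s _ => ?_
    have : ∀ G, (Measure.pi fun i => N.nodeSampleLaw (B.nodeLaw n i) G) s
        = ∑ x ∈ s.toFinite.toFinset, ∏ i, N.nodeSampleLaw (B.nodeLaw n i) G {x i} := by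
      intro G
      simp_rw [← Measure.pi_singleton, sum_measure_singleton, Set.Finite.coe_toFinset]
    simp_rw [this]
    refine Finset.measurable_sum _ fun x _ => Finset.measurable_prod _ fun i _ => ?_
    exact (Measure.measurable_coe (measurableSet_singleton _)).comp (N.measurable_nodeSampleLaw _)

instance (n : ℕ) [NeZero n] (B : Batch) : IsMarkovKernel (N.batchKernel n B) :=
  ⟨fun G => inferInstanceAs
    (IsProbabilityMeasure (Measure.pi fun i => N.nodeSampleLaw (B.nodeLaw n i) G))⟩

theorem stepLaw_eq_compProd (μS : ∀ n, Measure (AttrGraph (d 0) 𝒴 ℰ (Fin n)))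
    [∀ n, IsProbabilityMeasure (μS n)] (n : ℕ) [NeZero n] (B : Batch) :
    N.stepLaw μS n B = μS n ⊗ₘ N.batchKernel n B := by
  have hmap : ∀ (G : AttrGraph (d 0) 𝒴 ℰ (Fin n)) (s : Set (N.StepSample n (B.size n))),
      MeasurableSet s →
      Measure.map (fun x => (G, x)) (Measure.pi fun i => N.nodeSampleLaw (B.nodeLaw n i) G) s
        = N.batchKernel n B G (Prod.mk G ⁻¹' s) := fun G s hs =>
    Measure.map_apply measurable_prodMk_left hs
  ext s hs
  rw [stepLaw, Measure.bind_apply hs, Measure.compProd_apply hs]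
  · exact lintegral_congr fun G => hmap G s hs
  · refine (Measure.measurable_of_measurable_coe _ fun s hs => ?_).aemeasurable
    simp_rw [hmap _ s hs]
    exact Kernel.measurable_kernel_prodMk_left hs

/-! ### The mean gradient of a sampled graph and its minibatch estimate -/

/-- Every loss on the graph `G` is smooth in the learning coefficients. -/
def GoodGraph (M K : ℝ) {n : ℕ} (G : AttrGraph (d 0) 𝒴 ℰ (Fin n)) : Prop :=
  ∀ v C, IsSmoothWith M K (fun W => N.nodeLoss W G v C) (gradient fun W => N.nodeLoss W G v C)

/-- The gradient of the mean loss over the nodes and the computational graphs of `G`. -/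
def meanGrad {n : ℕ} (G : AttrGraph (d 0) 𝒴 ℰ (Fin n)) (W : Vec p) : Vec p :=
  ∫ v, ∫ C, gradient (fun W' => N.nodeLoss W' G v C) W ∂(N.sampler G v) ∂(uniformOn Set.univ)

variable {N} in
theorem GoodGraph.isSmoothWith_rootMean {M K : ℝ} {n : ℕ} [NeZero n]
    {G : AttrGraph (d 0) 𝒴 ℰ (Fin n)} (hG : N.GoodGraph M K G) :
    IsSmoothWith M K (fun W => rootMean (N.rootLoss W) G) (N.meanGrad G) := by
  have h := IsSmoothWith.integral (uniformOn (Set.univ : Set (Fin n))) fun v =>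
    IsSmoothWith.integral (N.sampler G v) fun C => hG v C
  have he : (fun W => rootMean (N.rootLoss W) G)
      = fun W => ∫ v, ∫ C, N.nodeLoss W G v C ∂(N.sampler G v) ∂(uniformOn Set.univ) := by
    ext W
    rw [integral_uniformOn_univ_fin, smul_eq_mul, rootMean, div_eq_inv_mul]
    rfl
  rw [he]
  exact h

theorem mean_integral_nodeSampleLaw (n : ℕ) [NeZero n] (B : Batch) (hB : 0 < B.size n)
    (G : AttrGraph (d 0) 𝒴 ℰ (Fin n)) (W : Vec p) :
    (B.size n : ℝ)⁻¹ • ∑ i, ∫ q, gradient (fun W' => N.nodeLoss W' G q.1 q.2) W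
      ∂(N.nodeSampleLaw (B.nodeLaw n i) G) = N.meanGrad G W := by
  simp_rw [integral_nodeSampleLaw]
  cases B with
  | iid b =>
    have hb : (b : ℝ) ≠ 0 := by exact_mod_cast hB.ne'
    change (b : ℝ)⁻¹ • ∑ _i : Fin b, N.meanGrad G W = _
    rw [Finset.sum_const, Finset.card_univ, Fintype.card_fin, ← Nat.cast_smul_eq_nsmul ℝ,
      inv_smul_smul₀ hb]
  | full =>
    rw [meanGrad, integral_uniformOn_univ_fin]
    change (n : ℝ)⁻¹ • ∑ i : Fin n, ∫ v, _ ∂(Measure.dirac i) = _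
    simp only [integral_dirac]

variable {N} in
theorem GoodGraph.norm_batchGrad_le {M K : ℝ} {n m : ℕ} {G : AttrGraph (d 0) 𝒴 ℰ (Fin n)}
    (hG : N.GoodGraph M K G) (hK : 0 ≤ K) (W : Vec p)
    (s : Fin m → Fin n × CompGraph L (Fin n)) : ‖N.batchGrad W (G, s)‖ ≤ K := by
  rw [batchGrad, norm_smul, norm_inv, Real.norm_natCast]
  rcases Nat.eq_zero_or_pos m with rfl | hm
  · simpa using hK
  · rw [inv_mul_le_iff₀ (by exact_mod_cast hm)]
    refine (norm_sum_le _ _).trans ?_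
    refine (Finset.sum_le_sum fun i _ => (hG (s i).1 (s i).2).norm_grad_le W).trans ?_
    simp

variable {N} in
/-- Given a good graph, the minibatch gradient estimates the mean gradient without bias. -/
theorem GoodGraph.lintegral_batchGrad_le {M K : ℝ} {n : ℕ} [NeZero n]
    {G : AttrGraph (d 0) 𝒴 ℰ (Fin n)} (hG : N.GoodGraph M K G) (B : Batch) (hB : 0 < B.size n)
    (W c : Vec p) :
    ∫⁻ s, ENNReal.ofReal (‖N.batchGrad W (G, s) - c‖ ^ 2) ∂(N.batchKernel n B G) ≤
      ENNReal.ofReal (K ^ 2 / B.size n) + ENNReal.ofReal (‖N.meanGrad G W - c‖ ^ 2) := by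
  rw [← ofReal_integral_eq_lintegral_ofReal .of_finite
    (Eventually.of_forall fun s => by positivity),
    ← ENNReal.ofReal_add (by positivity) (by positivity)]
  refine ENNReal.ofReal_le_ofReal ?_
  rw [← N.mean_integral_nodeSampleLaw n B hB]
  exact integral_norm_mean_sub_sq_le hB (fun i => N.nodeSampleLaw (B.nodeLaw n i) G)
    (fun q => gradient (fun W' => N.nodeLoss W' G q.1 q.2) W)
    (fun q => (hG q.1 q.2).norm_grad_le W) c

/-! ### Restriction to good graphs -/

open Classical in
/-- The minibatch gradient, set to `0` outside a set `S` of graphs. For a measurable set `S` of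
good graphs it is jointly measurable, which `batchGrad` need not be. -/
def cutGrad {n m : ℕ} (S : Set (AttrGraph (d 0) 𝒴 ℰ (Fin n))) (W : Vec p)
    (s : N.StepSample n m) : Vec p :=
  if s.1 ∈ S then N.batchGrad W s else 0

theorem measurable_indicator_gradient {α : Type*} [MeasurableSpace α] {S : Set α}
    (hS : MeasurableSet S) {F : α → Vec p → ℝ} (hF : ∀ W, Measurable fun x => F x W)
    (hd : ∀ x ∈ S, Differentiable ℝ (F x)) (W : Vec p) :
    Measurable (S.indicator fun x => gradient (F x) W) := by
  suffices h : Measurable fun x j => (S.indicator (fun x => gradient (F x) W) x) j from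
    (MeasurableEquiv.toLp 2 (Fin p → ℝ)).measurable.comp h
  refine measurable_pi_lambda _ fun j => ?_
  -- the coordinates are limits of difference quotients
  refine measurable_of_tendsto_metrizable (f := fun (k : ℕ) => S.indicator fun x =>
    ((k : ℝ) + 1) * (F x (W + ((k : ℝ) + 1)⁻¹ • EuclideanSpace.single j 1) - F x W))
    (fun k => ?_) ?_
  · exact (((hF _).sub (hF _)).const_mul _).indicator hS
  · rw [tendsto_pi_nhds]
    intro x
    by_cases hx : x ∈ S
    · have h1 := (hd x hx W).hasFDerivAt.lim_real (EuclideanSpace.single j 1)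
      have h2 : Tendsto (fun k : ℕ => (k : ℝ) + 1) atTop atTop :=
        tendsto_atTop_add_const_right _ _ tendsto_natCast_atTop_atTop
      have h3 := h1.comp h2
      have h4 : fderiv ℝ (F x) W (EuclideanSpace.single j 1) = gradient (F x) W j := by
        rw [← InnerProductSpace.toDual_symm_apply (𝕜 := ℝ), ← gradient,
          EuclideanSpace.inner_single_right]
        simp
      rw [h4] at h3
      simpa [hx, Function.comp_def] using h3
    · simp [hx]

variable {N} in
theorem measurable_uncurry_cutGrad (hmeas : N.MeasurableLoss) {M K : ℝ} {n m : ℕ}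
    {S : Set (AttrGraph (d 0) 𝒴 ℰ (Fin n))} (hS : MeasurableSet S)
    (hgood : ∀ G ∈ S, N.GoodGraph M K G) :
    Measurable (Function.uncurry (N.cutGrad (m := m) S)) := by
  have hsw : Measurable (Function.uncurry fun (W : Vec p) (s : N.StepSample n m) =>
      N.cutGrad S W s) := by
    refine measurable_uncurry_of_continuous_of_measurable (fun s => ?_) fun W => ?_
    · by_cases hs : s.1 ∈ S
      · simp only [cutGrad, if_pos hs, batchGrad]
        have := fun i => (hgood _ hs (s.2 i).1 (s.2 i).2).continuous_grad
        fun_prop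
      · simp only [cutGrad, if_neg hs]
        exact continuous_const
    · refine measurable_from_prod_countable_left fun r => ?_
      have : (fun G => N.cutGrad S W (G, r)) = fun G => (m : ℝ)⁻¹ • ∑ i, S.indicator
          (fun G => gradient (fun W' => N.nodeLoss W' G (r i).1 (r i).2) W) G := by
        ext1 G
        by_cases hG : G ∈ S <;> simp [cutGrad, batchGrad, hG]
      rw [this]
      have hi : ∀ i, Measurable fun G => S.indicator
          (fun G => gradient (fun W' => N.nodeLoss W' G (r i).1 (r i).2) W) G := fun i =>
        measurable_indicator_gradient hS (fun W' => hmeas n (r i).1 (r i).2 W')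
          (fun G hG => (hgood G hG (r i).1 (r i).2).differentiable) W
      fun_prop
  exact hsw

variable {N} in
theorem norm_cutGrad_le {M K : ℝ} (hK : 0 ≤ K) {n m : ℕ} {S : Set (AttrGraph (d 0) 𝒴 ℰ (Fin n))}
    (hgood : ∀ G ∈ S, N.GoodGraph M K G) (W : Vec p) (s : N.StepSample n m) :
    ‖N.cutGrad S W s‖ ≤ K := by
  by_cases hs : s.1 ∈ S
  · simpa only [cutGrad, if_pos hs] using (hgood _ hs).norm_batchGrad_le hK W s.2
  · simpa only [cutGrad, if_neg hs, norm_zero] using hK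

/-- The mean squared error of the mean gradient of a random graph as an estimate of `g W`. -/
def graphError {n : ℕ} (γ : Measure (AttrGraph (d 0) 𝒴 ℰ (Fin n))) (g : Vec p → Vec p)
    (W : Vec p) : ℝ≥0∞ :=
  ∫⁻ G, ENNReal.ofReal (‖N.meanGrad G W - g W‖ ^ 2) ∂γ

variable {N} in
/-- The error of the minibatch gradient splits into the sampling error of the minibatch, and the
error of the mean gradient of the sampled graph. -/
theorem gradError_cutGrad_le (hmeas : N.MeasurableLoss) {M K : ℝ}
    {μS : ∀ n, Measure (AttrGraph (d 0) 𝒴 ℰ (Fin n))} [∀ n, IsProbabilityMeasure (μS n)]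
    {n : ℕ} [NeZero n] {B : Batch} (hB : 0 < B.size n) {S : Set (AttrGraph (d 0) 𝒴 ℰ (Fin n))}
    (hS : MeasurableSet S) (hS' : ∀ᵐ G ∂(μS n), G ∈ S) (hgood : ∀ G ∈ S, N.GoodGraph M K G)
    (g : Vec p → Vec p) (W : Vec p) :
    gradError (N.stepLaw μS n B) (N.cutGrad S) g W ≤
      ENNReal.ofReal (K ^ 2 / B.size n) + N.graphError (μS n) g W := by
  have hm : Measurable fun s : N.StepSample n (B.size n) =>
      ENNReal.ofReal (‖N.cutGrad S W s - g W‖ ^ 2) := by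
    have : Measurable fun s : N.StepSample n (B.size n) => N.cutGrad S W s :=
      (measurable_uncurry_cutGrad hmeas hS hgood).comp measurable_prodMk_left
    fun_prop
  have hc : ENNReal.ofReal (K ^ 2 / B.size n)
      = ∫⁻ _, ENNReal.ofReal (K ^ 2 / B.size n) ∂(μS n) := by simp
  rw [gradError, stepLaw_eq_compProd, Measure.lintegral_compProd hm, graphError, hc,
    ← lintegral_add_left measurable_const]
  refine lintegral_mono_ae (hS'.mono fun G hG => ?_)
  simp only [cutGrad, if_pos hG]
  exact (hgood G hG).lintegral_batchGrad_le B hB W (g W)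

variable {N} in
/-- Almost surely, training with the minibatch gradient and with its restriction to a set of full
measure produce the same coefficients. -/
theorem IsRun.ae_weights_eq {μS : ∀ n, Measure (AttrGraph (d 0) 𝒴 ℰ (Fin n))}
    [∀ n, IsProbabilityMeasure (μS n)] {π₀ : Measure (Vec p)} {n : ℕ} [NeZero n] {B : Batch}
    {Ω : Type*} [MeasurableSpace Ω] {P : Measure Ω} {W₀ : Ω → Vec p}
    {ξ : ℕ → Ω → N.StepSample n (B.size n)} (hrun : N.IsRun μS π₀ n B P W₀ ξ)
    {S : Set (AttrGraph (d 0) 𝒴 ℰ (Fin n))} (hS : ∀ᵐ G ∂(μS n), G ∈ S)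
    (η : ℝ) :
    ∀ᵐ ω ∂P, N.weights η (W₀ ω) (fun s => ξ s ω)
      = sgdIter η (N.cutGrad S) (W₀ ω) fun s => ξ s ω := by
  have h1 : ∀ t, ∀ᵐ ω ∂P, (ξ t ω).1 ∈ S := by
    intro t
    have h2 : ∀ᵐ G ∂((P.map (ξ t)).map Prod.fst), G ∈ S := by
      have := Measure.fst_compProd (μS n) (N.batchKernel n B)
      rw [Measure.fst] at this
      rw [hrun.law_sample, stepLaw_eq_compProd, this]
      exact hS
    rw [Measure.map_map measurable_fst (hrun.measurable_sample t)] at h2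
    exact ae_of_ae_map (measurable_fst.comp (hrun.measurable_sample t)).aemeasurable h2
  filter_upwards [ae_all_iff.2 h1] with ω hω
  funext t
  induction t with
  | zero => rfl
  | succ t ih => simp only [weights, sgdIter, ih, cutGrad, if_pos (hω t)]

end SamplingGNN

/-! ### The limit loss -/

/-- The filter of the sets of pairs `(n, x)` whose complement has `γ n`-measure tending to `0`.
Convergence along it is convergence in probability. -/
def inProbability {X : ℕ → Type*} [∀ n, MeasurableSpace (X n)] (γ : ∀ n, Measure (X n)) :
    Filter (Σ n, X n) where
  sets := {A | Tendsto (fun n => γ n {x | (⟨n, x⟩ : Σ n, X n) ∉ A}) atTop (𝓝 0)}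
  univ_sets := by simp
  sets_of_superset {A A'} hA h :=
    tendsto_of_tendsto_of_tendsto_of_le_of_le tendsto_const_nhds hA (fun _ => zero_le)
      fun n => measure_mono fun _ hx hx' => hx (h hx')
  inter_sets {A A'} hA hA' := by
    have := Tendsto.add (Set.mem_ofPred_eq ▸ hA) (Set.mem_ofPred_eq ▸ hA')
    rw [add_zero] at this
    refine tendsto_of_tendsto_of_tendsto_of_le_of_le tendsto_const_nhds this (fun _ => zero_le)
      fun n => (measure_mono fun x hx => ?_).trans (measure_union_le _ _)
    by_contra hc
    simp only [Set.mem_union, Set.mem_ofPred_eq, not_or, not_not] at hc hx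
    exact hx hc

theorem mem_inProbability {X : ℕ → Type*} [∀ n, MeasurableSpace (X n)] {γ : ∀ n, Measure (X n)}
    {A : Set (Σ n, X n)} :
    A ∈ inProbability γ ↔ Tendsto (fun n => γ n {x | (⟨n, x⟩ : Σ n, X n) ∉ A}) atTop (𝓝 0) :=
  Iff.rfl

instance {X : ℕ → Type*} [∀ n, MeasurableSpace (X n)] (γ : ∀ n, Measure (X n))
    [∀ n, IsProbabilityMeasure (γ n)] : (inProbability γ).NeBot := by
  refine ⟨fun h => ?_⟩
  have : (∅ : Set (Σ n, X n)) ∈ inProbability γ := h ▸ mem_bot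
  rw [mem_inProbability] at this
  simp at this

namespace SamplingGNN

variable {𝒴 ℰ : Type} [MeasurableSpace 𝒴] [MeasurableSpace ℰ]
  {p : ℕ} {d a : ℕ → ℕ} {L : ℕ} {N : SamplingGNN 𝒴 ℰ p d a L}
  {μS : ∀ n, Measure (AttrGraph (d 0) 𝒴 ℰ (Fin n))}

theorem RegularLoss.ae_goodGraph {M : ℝ} {K : ℝ≥0} (h : N.RegularLoss μS M K) (n : ℕ) :
    ∀ᵐ G ∂(μS n), N.GoodGraph M K G :=
  (h n).mono fun _ hG v C =>
    .of_lipschitz (hG v C).1 (hG v C).2.1 (hG v C).2.2.1 (hG v C).2.2.2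

/-- The limit in probability of the mean losses is smooth, because it is a pointwise limit along
the filter of convergence in probability. -/
theorem RegularLoss.exists_isSmoothWith [∀ n, IsProbabilityMeasure (μS n)] {M : ℝ} {K : ℝ≥0}
    (h : N.RegularLoss μS M K) {ℓ : Vec p → ℝ}
    (hlim : ∀ W, RootMeanTendsto μS (N.rootLoss W) (ℓ W)) : ∃ g, IsSmoothWith M K ℓ g := by
  refine IsSmoothWith.exists_of_tendsto (l := inProbability μS)
    (F := fun x W => rootMean (N.rootLoss W) x.2) (G := fun x => N.meanGrad x.2) ?_ fun W => ?_
  · change _ ∈ _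
    rw [mem_inProbability]
    refine tendsto_const_nhds.congr' ?_
    filter_upwards [eventually_ne_atTop 0] with n hn
    have : NeZero n := ⟨hn⟩
    refine (measure_mono_null ?_ (ae_iff.1 (h.ae_goodGraph n))).symm
    exact fun G hG hgood => hG hgood.isSmoothWith_rootMean
  · rw [Metric.tendsto_nhds]
    intro δ hδ
    change _ ∈ _
    rw [mem_inProbability]
    simpa [Real.dist_eq] using hlim W δ hδ

/-- If the mean loss is close to `ℓ` with high probability at `W` and at nearby points in all
coordinate directions, then the mean gradient is close to `g` in mean square at `W`. The distance
of the nearby points is the square root of the tolerance. -/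
theorem exists_graphError_le {M K : ℝ} {ℓ : Vec p → ℝ} {g : Vec p → Vec p}
    (hs : IsSmoothWith M K ℓ g) {κ : ℝ} (hκ : 0 < κ) :
    ∃ h : ℝ, 0 < h ∧ ∀ (n : ℕ) [NeZero n] (γ : Measure (AttrGraph (d 0) 𝒴 ℰ (Fin n)))
      [IsProbabilityMeasure γ], (∀ᵐ G ∂γ, N.GoodGraph M K G) → ∀ W : Vec p,
      γ {G | h ^ 2 ≤ |rootMean (N.rootLoss W) G - ℓ W|} ≤ ENNReal.ofReal (h ^ 2) →
      (∀ i, γ {G | h ^ 2 ≤ |rootMean (N.rootLoss (W + h • EuclideanSpace.single i 1)) G -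
        ℓ (W + h • EuclideanSpace.single i 1)|} ≤ ENNReal.ofReal (h ^ 2)) →
      N.graphError γ g W ≤ ENNReal.ofReal κ := by
  -- the squared finite-difference error, plus the trivial bound on the bad event, vanishes with `h`
  obtain ⟨h, hh, hsmall⟩ : ∃ h : ℝ, 0 < h ∧
      (p * (2 * K * h + 2 * h ^ 2 / h)) ^ 2 + (2 * K) ^ 2 * ((p + 1) * h ^ 2) ≤ κ := by
    have hc : Continuous fun h : ℝ =>
        (p * (2 * K * h + 2 * h)) ^ 2 + (2 * K) ^ 2 * ((p + 1) * h ^ 2) := by fun_prop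
    have ht := (hc.tendsto 0).mono_left (nhdsWithin_le_nhds (s := Set.Ioi 0))
    simp only [mul_zero, add_zero, ne_eq, OfNat.ofNat_ne_zero, not_false_eq_true, zero_pow] at ht
    obtain ⟨h, h1, h2⟩ := ((ht.eventually_le_const hκ).and self_mem_nhdsWithin).exists
    have h2 : 0 < h := h2
    have : 2 * h ^ 2 / h = 2 * h := by field_simp
    exact ⟨h, h2, by rw [this]; exact h1⟩
  refine ⟨h, hh, fun n _ γ _ hgood W h0 hi => ?_⟩
  set q := p * (2 * K * h + 2 * h ^ 2 / h)
  set B₀ := {G | h ^ 2 ≤ |rootMean (N.rootLoss W) G - ℓ W|}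
  set B := fun i => {G | h ^ 2 ≤ |rootMean (N.rootLoss (W + h • EuclideanSpace.single i 1)) G -
    ℓ (W + h • EuclideanSpace.single i 1)|}
  have hbad : γ (B₀ ∪ ⋃ i, B i) ≤ ENNReal.ofReal ((p + 1) * h ^ 2) := by
    calc γ (B₀ ∪ ⋃ i, B i) ≤ γ B₀ + ∑ i, γ (B i) :=
          (measure_union_le _ _).trans (by gcongr; exact measure_iUnion_fintype_le _ _)
      _ ≤ ENNReal.ofReal (h ^ 2) + ∑ _i : Fin p, ENNReal.ofReal (h ^ 2) := by
          gcongr with i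
          exact hi i
      _ = ENNReal.ofReal ((p + 1) * h ^ 2) := by
          rw [Finset.sum_const, Finset.card_univ, Fintype.card_fin, nsmul_eq_mul,
            ← ENNReal.ofReal_natCast, ← ENNReal.ofReal_mul (by positivity),
            ← ENNReal.ofReal_add (by positivity) (by positivity)]
          congr 1
          ring
  have hpt : ∀ᵐ G ∂γ, ENNReal.ofReal (‖N.meanGrad G W - g W‖ ^ 2) ≤ ENNReal.ofReal (q ^ 2) +
      (B₀ ∪ ⋃ i, B i).indicator (fun _ => ENNReal.ofReal ((2 * K) ^ 2)) G := by
    filter_upwards [hgood] with G hG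
    have hG' := hG.isSmoothWith_rootMean
    by_cases hmem : G ∈ B₀ ∪ ⋃ i, B i
    · rw [Set.indicator_of_mem hmem]
      refine le_trans (ENNReal.ofReal_le_ofReal ?_) le_add_self
      have := norm_sub_le (N.meanGrad G W) (g W)
      have h1 := hG'.norm_grad_le W
      have h2 := hs.norm_grad_le W
      gcongr
      linarith
    · refine le_trans (ENNReal.ofReal_le_ofReal ?_) le_self_add
      simp only [B₀, B, Set.mem_union, Set.mem_iUnion, Set.mem_ofPred_eq, not_or, not_exists,
        not_le] at hmem
      have := hG'.norm_grad_sub_le hs hh W hmem.1.le fun i => (hmem.2 i).le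
      gcongr
  calc N.graphError γ g W ≤ _ := lintegral_mono_ae hpt
    _ ≤ ENNReal.ofReal (q ^ 2) +
        ENNReal.ofReal ((2 * K) ^ 2) * ENNReal.ofReal ((p + 1) * h ^ 2) := by
        rw [lintegral_add_left measurable_const]
        gcongr
        · simp
        · exact (lintegral_indicator_const_le _ _).trans (by gcongr)
    _ ≤ ENNReal.ofReal κ := by
        rw [← ENNReal.ofReal_mul (by positivity),
          ← ENNReal.ofReal_add (by positivity) (by positivity)]
        exact ENNReal.ofReal_le_ofReal hsmall

variable [∀ n, IsProbabilityMeasure (μS n)] {M : ℝ} {K : ℝ≥0} {ℓ : Vec p → ℝ}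
  {g : Vec p → Vec p}

theorem RegularLoss.eventually_graphError_le (h : N.RegularLoss μS M K)
    (hs : IsSmoothWith M K ℓ g) (hlim : ∀ W, RootMeanTendsto μS (N.rootLoss W) (ℓ W))
    (W : Vec p) {κ : ℝ} (hκ : 0 < κ) :
    ∀ᶠ n in atTop, N.graphError (μS n) g W ≤ ENNReal.ofReal κ := by
  obtain ⟨r, hr, hmain⟩ := exists_graphError_le (N := N) hs hκ
  have hr2 : 0 < r ^ 2 := by positivity
  have hev : ∀ W, ∀ᶠ n in atTop, μS n {G | r ^ 2 ≤ |rootMean (N.rootLoss W) G - ℓ W|} ≤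
      ENNReal.ofReal (r ^ 2) := fun W =>
    (hlim W _ hr2).eventually_le_const (ENNReal.ofReal_pos.2 hr2)
  filter_upwards [eventually_ne_atTop 0, hev W, eventually_all.2 fun i : Fin p =>
    hev (W + r • EuclideanSpace.single i 1)] with n hn h0 hi
  have : NeZero n := ⟨hn⟩
  exact hmain n (μS n) (h.ae_goodGraph n) W h0 hi

theorem RegularLoss.eventually_forall_graphError_le (h : N.RegularLoss μS M K)
    (hs : IsSmoothWith M K ℓ g) (hlim : UniformRootMeanTendsto μS N.rootLoss ℓ)
    {κ : ℝ} (hκ : 0 < κ) :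
    ∀ᶠ n in atTop, ∀ W, N.graphError (μS n) g W ≤ ENNReal.ofReal κ := by
  obtain ⟨r, hr, hmain⟩ := exists_graphError_le (N := N) hs hκ
  filter_upwards [eventually_ne_atTop 0, hlim (r ^ 2) (by positivity)] with n hn h0 W
  have : NeZero n := ⟨hn⟩
  exact hmain n (μS n) (h.ae_goodGraph n) W (h0 W) fun i => h0 _

/-- The convergence of the mean gradients is uniform on balls, since they are Lipschitz with a
common constant. -/
theorem RegularLoss.eventually_forall_mem_ball_graphError_le (h : N.RegularLoss μS M K)
    (hs : IsSmoothWith M K ℓ g) (hlim : ∀ W, RootMeanTendsto μS (N.rootLoss W) (ℓ W))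
    (R : ℝ) {κ : ℝ} (hκ : 0 < κ) :
    ∀ᶠ n in atTop, ∀ W, ‖W‖ ≤ R → N.graphError (μS n) g W ≤ ENNReal.ofReal κ := by
  have hK : (0 : ℝ) ≤ K := K.2
  set r : ℝ := √κ / (4 * (K + 1)) with hr
  have hr0 : 0 < r := by positivity
  have hrκ : 2 * (2 * K * r) ^ 2 ≤ κ / 2 := by
    have h1 : 4 * (K + 1) * r = √κ := by rw [hr]; field_simp
    have h2 : (4 * (K + 1) * r) ^ 2 = κ := by rw [h1, Real.sq_sqrt hκ.le]
    have h3 : (4 * K * r) ^ 2 ≤ (4 * (K + 1) * r) ^ 2 := by gcongr; linarith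
    nlinarith
  obtain ⟨t, -, htf, ht⟩ := (isCompact_closedBall (0 : Vec p) R).finite_cover_balls hr0
  have hev : ∀ᶠ n in atTop, ∀ W ∈ t, N.graphError (μS n) g W ≤ ENNReal.ofReal (κ / 4) :=
    (eventually_all_finite htf).2 fun W _ =>
      h.eventually_graphError_le hs hlim W (by positivity)
  filter_upwards [eventually_ne_atTop 0, hev] with n hn hn' W hW
  have : NeZero n := ⟨hn⟩
  obtain ⟨W', hW't, hW'⟩ := Set.mem_iUnion₂.1 (ht (by simpa using hW : W ∈ Metric.closedBall 0 R))
  rw [Metric.mem_ball, dist_eq_norm] at hW'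
  have hpt : ∀ᵐ G ∂(μS n), ENNReal.ofReal (‖N.meanGrad G W - g W‖ ^ 2) ≤
      ENNReal.ofReal (κ / 2) + ENNReal.ofReal 2 *
        ENNReal.ofReal (‖N.meanGrad G W' - g W'‖ ^ 2) := by
    filter_upwards [h.ae_goodGraph n] with G hG
    rw [← ENNReal.ofReal_mul (by positivity), ← ENNReal.ofReal_add (by positivity) (by positivity)]
    refine ENNReal.ofReal_le_ofReal ?_
    have h1 := hG.isSmoothWith_rootMean.lipschitz W' W
    have h2 := hs.lipschitz W' W
    have h3 : K * ‖W - W'‖ ≤ K * r := by gcongr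
    have h4 : ‖N.meanGrad G W - g W‖ ≤ ‖N.meanGrad G W' - g W'‖ + 2 * K * r := by
      calc ‖N.meanGrad G W - g W‖
          = ‖(N.meanGrad G W' - g W') + (N.meanGrad G W - N.meanGrad G W') - (g W - g W')‖ := by
            congr 1; abel
        _ ≤ ‖N.meanGrad G W' - g W'‖ + ‖N.meanGrad G W - N.meanGrad G W'‖ + ‖g W - g W'‖ :=
            (norm_sub_le _ _).trans (by gcongr; exact norm_add_le _ _)
        _ ≤ _ := by linarith
    have h5 : ‖N.meanGrad G W - g W‖ ^ 2 ≤ (‖N.meanGrad G W' - g W'‖ + 2 * K * r) ^ 2 := by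
      gcongr
    nlinarith [sq_nonneg (‖N.meanGrad G W' - g W'‖ - 2 * K * r)]
  refine (lintegral_mono_ae hpt).trans ?_
  rw [lintegral_add_left measurable_const, lintegral_const_mul' _ _ ENNReal.ofReal_ne_top]
  calc _ ≤ ENNReal.ofReal (κ / 2) + ENNReal.ofReal 2 * ENNReal.ofReal (κ / 4) := by
        gcongr
        · simp
        · exact hn' W' hW't
    _ = ENNReal.ofReal κ := by
        rw [← ENNReal.ofReal_mul (by positivity),
          ← ENNReal.ofReal_add (by positivity) (by positivity)]
        congr 1
        ring

end SamplingGNN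

/-! ### Training runs -/

theorem exists_measure_norm_gt_le {E : Type*} [NormedAddCommGroup E] [MeasurableSpace E]
    [OpensMeasurableSpace E] (π : Measure E) [IsFiniteMeasure π] {τ : ℝ} (hτ : 0 < τ) :
    ∃ R : ℝ, π {W | R < ‖W‖} ≤ ENNReal.ofReal τ := by
  have h : Tendsto (fun k : ℕ => π {W : E | (k : ℝ) < ‖W‖}) atTop
      (𝓝 (π (⋂ k : ℕ, {W : E | (k : ℝ) < ‖W‖}))) := by
    refine tendsto_measure_iInter_atTop (fun k => ?_) (fun i j hij W hW => ?_)
      ⟨0, measure_ne_top _ _⟩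
    · exact (measurableSet_lt measurable_const measurable_norm).nullMeasurableSet
    · have hij : (i : ℝ) ≤ j := by exact_mod_cast hij
      exact hij.trans_lt hW
  have h0 : (⋂ k : ℕ, {W : E | (k : ℝ) < ‖W‖}) = ∅ := by
    ext W
    obtain ⟨k, hk⟩ := exists_nat_ge ‖W‖
    simpa using ⟨k, hk⟩
  rw [h0, measure_empty] at h
  obtain ⟨k, hk⟩ := (h.eventually_le_const (ENNReal.ofReal_pos.2 hτ)).exists
  exact ⟨k, hk⟩

theorem Batch.LargeEnough.le_size {Y n : ℕ} {B : Batch} (hB : B.LargeEnough Y) (hn : Y ≤ n) :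
    Y ≤ B.size n := by
  cases B with
  | iid b => exact hB
  | full => exact hn

/-- Within `T` steps the iterates stay in a ball, unless the initial value is large. Hence a bound
`κ` on the gradient error in that ball bounds the expected error along the trajectory. -/
theorem lintegral_gradError_sgdIter_le {p : ℕ} {𝒳 Ω : Type*} [MeasurableSpace 𝒳]
    [MeasurableSpace Ω] {P : Measure Ω} [IsProbabilityMeasure P] {ν : Measure 𝒳}
    [IsProbabilityMeasure ν] {Z : Ω → Vec p} (hZ : Measurable Z) (ξ : ℕ → Ω → 𝒳) {η K R κ τ : ℝ}
    (hη : 0 ≤ η) {Θ : Vec p → 𝒳 → Vec p} {g : Vec p → Vec p} (hΘ : ∀ W x, ‖Θ W x‖ ≤ K)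
    (hg : ∀ W, ‖g W‖ ≤ K) {T : ℕ}
    (hball : ∀ W, ‖W‖ ≤ R + T * (η * K) → gradError ν Θ g W ≤ ENNReal.ofReal κ)
    (htail : P.map Z {W | R < ‖W‖} ≤ ENNReal.ofReal τ) {t : ℕ} (ht : t ≤ T) :
    ∫⁻ ω, gradError ν Θ g (sgdIter η Θ (Z ω) (fun s => ξ s ω) t) ∂P ≤
      ENNReal.ofReal κ + ENNReal.ofReal ((2 * K) ^ 2) * ENNReal.ofReal τ := by
  have hK : 0 ≤ K := (norm_nonneg _).trans (hg 0)
  have hconst : ∀ W, gradError ν Θ g W ≤ ENNReal.ofReal ((2 * K) ^ 2) := by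
    intro W
    calc gradError ν Θ g W ≤ ∫⁻ _, ENNReal.ofReal ((2 * K) ^ 2) ∂ν := by
          refine lintegral_mono fun x => ENNReal.ofReal_le_ofReal ?_
          have := (norm_sub_le (Θ W x) (g W)).trans (add_le_add (hΘ W x) (hg W))
          gcongr
          linarith
      _ = _ := by simp
  have hm : MeasurableSet {W : Vec p | R < ‖W‖} :=
    measurableSet_lt measurable_const measurable_norm
  rw [Measure.map_apply hZ hm] at htail
  have hpt : ∀ ω, gradError ν Θ g (sgdIter η Θ (Z ω) (fun s => ξ s ω) t) ≤ ENNReal.ofReal κ +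
      (Z ⁻¹' {W | R < ‖W‖}).indicator (fun _ => ENNReal.ofReal ((2 * K) ^ 2)) ω := by
    intro ω
    by_cases hω : R < ‖Z ω‖
    · rw [Set.indicator_of_mem (by exact hω)]
      exact (hconst _).trans le_add_self
    · refine (hball _ ?_).trans le_self_add
      refine (norm_sgdIter_le hη hΘ _ _ t).trans ?_
      have : (t : ℝ) ≤ T := by exact_mod_cast ht
      gcongr
      exact not_lt.1 hω
  refine (lintegral_mono hpt).trans ?_
  rw [lintegral_add_left measurable_const]
  gcongr
  · simp
  · exact (lintegral_indicator_const_le _ _).trans (by gcongr)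

namespace SamplingGNN

variable {𝒴 ℰ : Type} [MeasurableSpace 𝒴] [MeasurableSpace ℰ]
  {p : ℕ} {d a : ℕ → ℕ} {L : ℕ} {N : SamplingGNN 𝒴 ℰ p d a L}
  {μS : ∀ n, Measure (AttrGraph (d 0) 𝒴 ℰ (Fin n))}

theorem IsRun.isSGDInput {π₀ : Measure (Vec p)} {n : ℕ} {B : Batch} {Ω : Type*}
    [MeasurableSpace Ω] {P : Measure Ω} {W₀ : Ω → Vec p} {ξ : ℕ → Ω → N.StepSample n (B.size n)}
    (hrun : N.IsRun μS π₀ n B P W₀ ξ) : IsSGDInput W₀ ξ (N.stepLaw μS n B) P :=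
  ⟨hrun.measurable_init, hrun.measurable_sample, hrun.law_sample, hrun.indep_samples,
    hrun.indep_init⟩

theorem RegularLoss.exists_measurableSet_goodGraph {M : ℝ} {K : ℝ≥0} (h : N.RegularLoss μS M K)
    (n : ℕ) : ∃ S : Set (AttrGraph (d 0) 𝒴 ℰ (Fin n)), MeasurableSet S ∧
      (∀ᵐ G ∂(μS n), G ∈ S) ∧ ∀ G ∈ S, N.GoodGraph M K G := by
  obtain ⟨t, hsub, htm, ht⟩ := exists_measurable_superset_of_null (ae_iff.1 (h.ae_goodGraph n))
  refine ⟨tᶜ, htm.compl, ?_, fun G hG => ?_⟩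
  · rw [ae_iff]
    simpa using ht
  · by_contra hc
    exact hG (hsub hc)

/-- A graph error of at most `κ / 2` and a minibatch of at least `2 K² / κ` nodes make the error of
the minibatch gradient at most `κ`. -/
theorem gradError_cutGrad_le_of_graphError_le (hmeas : N.MeasurableLoss) {M K : ℝ}
    [∀ n, IsProbabilityMeasure (μS n)] {n : ℕ} [NeZero n] {B : Batch} {κ : ℝ} (hκ : 0 < κ)
    (hB : ⌈2 * K ^ 2 / κ⌉₊ < B.size n) {S : Set (AttrGraph (d 0) 𝒴 ℰ (Fin n))}
    (hS : MeasurableSet S) (hS' : ∀ᵐ G ∂(μS n), G ∈ S) (hgood : ∀ G ∈ S, N.GoodGraph M K G)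
    {g : Vec p → Vec p} {W : Vec p} (hW : N.graphError (μS n) g W ≤ ENNReal.ofReal (κ / 2)) :
    gradError (N.stepLaw μS n B) (N.cutGrad S) g W ≤ ENNReal.ofReal κ := by
  have hB0 : 0 < B.size n := (Nat.zero_le _).trans_lt hB
  refine (gradError_cutGrad_le hmeas hB0 hS hS' hgood g W).trans ?_
  have hsize : 2 * K ^ 2 / κ ≤ B.size n := (Nat.le_ceil _).trans (by exact_mod_cast hB.le)
  have hb : K ^ 2 / B.size n ≤ κ / 2 := by
    have : (0 : ℝ) < B.size n := by exact_mod_cast hB0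
    rw [div_le_iff₀ hκ] at hsize
    rw [div_le_iff₀ this]
    linarith
  calc _ ≤ ENNReal.ofReal (κ / 2) + ENNReal.ofReal (κ / 2) := by gcongr
    _ = ENNReal.ofReal κ := by
      rw [← ENNReal.ofReal_add (by positivity) (by positivity), add_halves]

end SamplingGNN

open SamplingGNN

theorem mainTheorem1 {𝒴 ℰ : Type} [MeasurableSpace 𝒴] [MeasurableSpace ℰ]
    {p L : ℕ} {d a : ℕ → ℕ} (N : SamplingGNN 𝒴 ℰ p d a L) (hmeas : N.MeasurableLoss)
    (μS : ∀ n, Measure (AttrGraph (d 0) 𝒴 ℰ (Fin n))) [∀ n, IsProbabilityMeasure (μS n)]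
    (μ : Measure (RootedGraph (d 0) 𝒴 ℰ)) [IsProbabilityMeasure μ]
    (hconv : LocallyConverges μS μ)
    (M : ℝ) (K : ℝ≥0) (hreg : N.RegularLoss μS M K)
    (Llim : Vec p → Measure (RootedGraph (d 0) 𝒴 ℰ) → RootedGraph (d 0) 𝒴 ℰ → ℝ)
    (hloc : ∀ W, AlmostLocal (N.rootLoss W) (Llim W)) :
    Differentiable ℝ (limitLoss Llim μ) ∧
    ∃ η : ℝ, 0 < η ∧ ∃ A : ℝ, 0 < A ∧
      ∀ (π₀ : Measure (Vec p)), IsProbabilityMeasure π₀ →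
        (∀ ε : ℝ, 0 < ε → ∀ T : ℕ, ∃ Nε Yε : ℕ, ∀ n, Nε ≤ n → ∀ B : Batch, B.LargeEnough Yε →
          ∀ (Ω : Type*) [MeasurableSpace Ω] (P : Measure Ω) [IsProbabilityMeasure P]
            (W₀ : Ω → Vec p) (ξ : ℕ → Ω → N.StepSample n (B.size n)),
            N.IsRun μS π₀ n B P W₀ ξ →
              (∃ t : ℕ, (t : ℝ) ≤ A / ε ^ 2 ∧
                ∫⁻ ω, ‖gradient (limitLoss Llim μ) (N.weights η (W₀ ω) (fun s => ξ s ω) t)‖ₑ ∂P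
                  ≤ ENNReal.ofReal ε) ∧
              ∫⁻ ω, min (numSteps (limitLoss Llim μ) ε (N.weights η (W₀ ω) (fun s => ξ s ω))) T ∂P
                ≤ ENNReal.ofReal (A / ε ^ 2)) ∧
        (UniformRootMeanTendsto μS N.rootLoss (limitLoss Llim μ) →
          ∀ ε : ℝ, 0 < ε → ∃ Nε Yε : ℕ, ∀ n, Nε ≤ n → ∀ B : Batch, B.LargeEnough Yε →
          ∀ (Ω : Type*) [MeasurableSpace Ω] (P : Measure Ω) [IsProbabilityMeasure P]
            (W₀ : Ω → Vec p) (ξ : ℕ → Ω → N.StepSample n (B.size n)),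
            N.IsRun μS π₀ n B P W₀ ξ →
              ∫⁻ ω, numSteps (limitLoss Llim μ) ε (N.weights η (W₀ ω) (fun s => ξ s ω)) ∂P
                ≤ ENNReal.ofReal (A / ε ^ 2)) := by
  have hlim : ∀ W, RootMeanTendsto μS (N.rootLoss W) (limitLoss Llim μ W) := fun W =>
    (hloc W μS μ inferInstance inferInstance hconv).2
  obtain ⟨g, hs⟩ := hreg.exists_isSmoothWith hlim
  have hK : (0 : ℝ) ≤ K := K.2
  have hM := hs.M_nonneg
  refine ⟨hs.differentiable, 1 / (2 * (K + 1)), by positivity, ?_⟩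
  set η : ℝ := 1 / (2 * (K + 1)) with hη'
  have hη : 0 < η := by positivity
  have hηK : η * K ≤ 1 / 2 := by
    rw [hη', div_mul_eq_mul_div, div_le_div_iff₀ (by positivity) (by norm_num)]
    linarith
  set c : ℝ := 4 * M / η with hc'
  have hc : 0 ≤ c := by positivity
  refine ⟨2 * c + 1, by positivity, fun π₀ hπ₀ => ⟨fun ε hε T => ?_, fun hunif ε hε => ?_⟩⟩
  · -- `H` bounds the number of steps to be controlled, `κ` the gradient error allowed in each
    set T' : ℕ := ⌊(2 * c + 1) / ε ^ 2⌋₊ + 1 with hT'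
    set H : ℕ := T + T' with hH
    set κ : ℝ := min (ε ^ 2 / 2) (1 / (T + 1)) with hκ'
    have hκ : 0 < κ := by positivity
    obtain ⟨R, hR⟩ := exists_measure_norm_gt_le π₀
      (τ := κ / (2 * ((2 * K) ^ 2 + 1))) (by positivity)
    obtain ⟨N₁, hN₁⟩ := eventually_atTop.1 (hreg.eventually_forall_mem_ball_graphError_le hs hlim
      (R + H * (η * K)) (κ := κ / 2 / 2) (by positivity))
    set Y : ℕ := ⌈2 * (K : ℝ) ^ 2 / (κ / 2)⌉₊ + 1 with hY
    refine ⟨max N₁ Y, Y, fun n hn B hB Ω _ P _ W₀ ξ hrun => ?_⟩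
    have hYn : Y ≤ n := (le_max_right _ _).trans hn
    have : NeZero n := ⟨by omega⟩
    obtain ⟨S, hS, hS', hgood⟩ := hreg.exists_measurableSet_goodGraph n
    have hΘ := measurable_uncurry_cutGrad (m := B.size n) hmeas hS hgood
    have hin := hrun.isSGDInput
    have : IsProbabilityMeasure (N.stepLaw μS n B) := by
      rw [stepLaw_eq_compProd]; infer_instance
    have herr : ∀ t ≤ H, ∫⁻ ω, gradError (N.stepLaw μS n B) (N.cutGrad S) g
        (sgdIter η (N.cutGrad S) (W₀ ω) (fun s => ξ s ω) t) ∂P ≤ ENNReal.ofReal κ := by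
      intro t ht
      refine (lintegral_gradError_sgdIter_le hrun.measurable_init ξ hη.le
        (norm_cutGrad_le hK hgood) hs.norm_grad_le (κ := κ / 2) (fun W hW => ?_)
        (hrun.law_init ▸ hR) ht).trans ?_
      · exact gradError_cutGrad_le_of_graphError_le hmeas (half_pos hκ)
          (Nat.lt_of_succ_le (hB.le_size hYn)) hS hS' hgood
          (hN₁ n ((le_max_left _ _).trans hn) W hW)
      · rw [← ENNReal.ofReal_mul (by positivity),
          ← ENNReal.ofReal_add (by positivity) (by positivity)]
        refine ENNReal.ofReal_le_ofReal ?_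
        have : (2 * (K : ℝ)) ^ 2 * (κ / (2 * ((2 * K) ^ 2 + 1))) ≤ κ / 2 := by
          rw [mul_div_assoc', div_le_div_iff₀ (by positivity) (by norm_num)]
          nlinarith
        linarith
    have hW := hrun.ae_weights_eq hS' η
    refine ⟨?_, ?_⟩
    · have hT2 : 2 * c < T' * ε ^ 2 := by
        have h1 := Nat.lt_floor_add_one ((2 * c + 1) / ε ^ 2)
        rw [div_lt_iff₀ (by positivity)] at h1
        rw [hT']
        push_cast
        linarith
      obtain ⟨t, ht, hle⟩ := hs.exists_lintegral_norm_grad_le hη hηK hΘ hin hε hT2 fun t ht =>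
        (herr t (by omega)).trans (ENNReal.ofReal_le_ofReal (min_le_left _ _))
      refine ⟨t, (Nat.le_floor_iff (by positivity)).1 (by omega), ?_⟩
      rw [hs.gradient_eq]
      refine le_trans (le_of_eq (lintegral_congr_ae ?_)) hle
      filter_upwards [hW] with ω hω
      rw [hω]
    · have hsum : ∑ t ∈ Finset.range T, ∫⁻ ω, gradError (N.stepLaw μS n B) (N.cutGrad S) g
          (sgdIter η (N.cutGrad S) (W₀ ω) (fun s => ξ s ω) t) ∂P ≤ 1 := by
        calc _ ≤ ∑ _t ∈ Finset.range T, ENNReal.ofReal (1 / (T + 1)) :=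
              Finset.sum_le_sum fun t ht => (herr t (by
                have := Finset.mem_range.1 ht; omega)).trans
                  (ENNReal.ofReal_le_ofReal (min_le_right _ _))
          _ = ENNReal.ofReal (T * (1 / (T + 1))) := by
              rw [Finset.sum_const, Finset.card_range, nsmul_eq_mul, ← ENNReal.ofReal_natCast,
                ← ENNReal.ofReal_mul (by positivity)]
          _ ≤ 1 := by
              rw [← ENNReal.ofReal_one]
              refine ENNReal.ofReal_le_ofReal ?_
              rw [mul_one_div, div_le_one (by positivity)]
              linarith
      calc _ = ∫⁻ ω, min (numSteps (limitLoss Llim μ) ε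
            (sgdIter η (N.cutGrad S) (W₀ ω) (fun s => ξ s ω))) T ∂P := by
            refine lintegral_congr_ae ?_
            filter_upwards [hW] with ω hω
            rw [hω]
        _ ≤ ENNReal.ofReal ((c + 1) / ε ^ 2) :=
            hs.lintegral_min_numSteps_le hη hηK hΘ hin hε hsum
        _ ≤ _ := by
            refine ENNReal.ofReal_le_ofReal ?_
            gcongr
            linarith
  · obtain ⟨N₁, hN₁⟩ := eventually_atTop.1 (hreg.eventually_forall_graphError_le hs hunif
      (κ := ε ^ 2 / 2 / 2) (by positivity))
    set Y : ℕ := ⌈2 * (K : ℝ) ^ 2 / (ε ^ 2 / 2)⌉₊ + 1 with hY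
    refine ⟨max N₁ Y, Y, fun n hn B hB Ω _ P _ W₀ ξ hrun => ?_⟩
    have hYn : Y ≤ n := (le_max_right _ _).trans hn
    have : NeZero n := ⟨by omega⟩
    obtain ⟨S, hS, hS', hgood⟩ := hreg.exists_measurableSet_goodGraph n
    have hΘ := measurable_uncurry_cutGrad (m := B.size n) hmeas hS hgood
    calc _ = ∫⁻ ω, numSteps (limitLoss Llim μ) ε
          (sgdIter η (N.cutGrad S) (W₀ ω) (fun s => ξ s ω)) ∂P := by
          refine lintegral_congr_ae ?_
          filter_upwards [hrun.ae_weights_eq hS' η] with ω hω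
          rw [hω]
      _ ≤ ENNReal.ofReal (2 * c / ε ^ 2) :=
          hs.lintegral_numSteps_le hη hηK hΘ hrun.isSGDInput hε fun W =>
            gradError_cutGrad_le_of_graphError_le hmeas (by positivity)
              (Nat.lt_of_succ_le (hB.le_size hYn)) hS hS' hgood
              (hN₁ n ((le_max_left _ _).trans hn) W)
      _ ≤ _ := by
          refine ENNReal.ofReal_le_ofReal ?_
          gcongr
          linarith

end
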